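/- For $\tau\in\mathbb{C}$ with $\operatorname{Im}\tau>0$ put $q=e^{2\pi i\tau}$ and $$V(\tau)=\prod_{n=1}^{\infty}\frac{(1-q^n)^5}{(1-q^{5n})^3}\Bigl(1+\tfrac{1-\sqrt5}{2}q^n+q^{2n}\Bigr)^5,\qquad W(\tau)=\prod_{n=1}^{\infty}\frac{(1-q^n)^5}{(1-q^{5n})^3}\Bigl(1+\tfrac{1+\sqrt5}{2}q^n+q^{2n}\Bigr)^5 .$$ Then $V$ has no zeros in the upper half plane; put $$v(\tau)=\frac{1}{5\sqrt5}\,\frac{W(\tau)-V(\tau)}{V(\tau)} .$$ (1) Let $\{a_5(n)\}_{n\ge0}$ be the sequence defined by $a_5(0)=1$ and, for $n\ge 0$, $$(n+1)^2a_5(n+1)+\Bigl\{\tfrac{11+15\sqrt5}{2}\,n(n+1)+\tfrac{5(1+\sqrt5)}{2}\Bigr\}a_5(n)+\tfrac{5(25+11\sqrt5)}{2}\,n^2a_5(n-1)=0$$ (for $n=0$ the last term is absent). There is $Y>0$ such that $|v(\tau)|<\sqrt5/25$ whenever $\operatorname{Im}\tau>Y$, and $$V(\tau)=\sum_{n=0}^{\infty}a_5(n)\,v(\tau)^n$$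 (the series converging absolutely) for every $\tau$ in the connected component of $\{\tau:\operatorname{Im}\tau>0,\ |v(\tau)|<\sqrt5/25\}$ that contains the half plane $\operatorname{Im}\tau>Y$. (2) Near every point of the upper half plane $v$ has a holomorphic local inverse: for every $\tau_0$ with $\operatorname{Im}\tau_0>0$ there are an open set $\Omega\ni v(\tau_0)$ and a holomorphic function $\tau(\cdot)$ from $\Omega$ to the upper half plane with $v(\tau(x))=x$ on $\Omega$ and $\tau(v(\tau_0))=\tau_0$. For every open set $\Omega\subseteq\mathbb{C}$ and every holomorphic $\tau(\cdot)$ from $\Omega$ to the upper half plane with $v(\tau(x))=x$ on $\Omega$, the set $\Omega$ contains none of the points $0$, $-\frac{\sqrt5}{25}$, $\frac{11-5\sqrt5}{2}$, and the function $x\mapsto V(\tau(x))$, written $V(v)$ with $v=x$, is holomorphic on $\Omega$ and satisfies there Heun's equation $$\frac{d^2V}{dv^2}+\Bigl\{\frac1v+\frac1{v+\frac{\sqrt5}{25}}+\frac1{v-\frac{11-5\sqrt5}{2}}\Bigr\}\frac{dV}{dv}+\frac{v-\frac{15-7\sqrt5}{10}}{v\,(v+\frac{\sqrt5}{25})(v-\frac{11-5\sqrt5}{2})}\,V=0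 .$$ -/

import Mathlib

noncomputable section

namespace LevelFive

/-- The nome `q = exp (2 π i τ)`. -/
def nome (τ : ℂ) : ℂ := Complex.exp (2 * Real.pi * Complex.I * τ)

/-- The product `∏_{n ≥ 1} (1 - q^n)^5 / (1 - q^(5 n))^3 * (1 + c q^n + q^(2 n))^5`,
with `q = exp (2 π i τ)` (the index of the Lean product is shifted by one). -/
def thetaProduct (c τ : ℂ) : ℂ :=
  ∏' n : ℕ, ((1 - nome τ ^ (n + 1)) ^ 5 / (1 - nome τ ^ (5 * (n + 1))) ^ 3
    * (1 + c * nome τ ^ (n + 1) + nome τ ^ (2 * (n + 1))) ^ 5)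

/-- The modular form `V` of level five. -/
def V (τ : ℂ) : ℂ := thetaProduct ((1 - (√5 : ℝ)) / 2) τ

/-- The modular form `W` of level five. -/
def W (τ : ℂ) : ℂ := thetaProduct ((1 + (√5 : ℝ)) / 2) τ

/-- The modular function `v = (W - V) / (5 √5 V)`. -/
def v (τ : ℂ) : ℂ := 1 / (5 * (√5 : ℝ)) * ((W τ - V τ) / V τ)

/-- The sequence `a₅`; the step solves the three-term recurrence for its leading term. -/
def a₅ : ℕ → ℝ
  | 0 => 1
  | 1 => -(5 * (1 + √5) / 2)
  | n + 2 =>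
      -(((11 + 15 * √5) / 2 * ((n : ℝ) + 1) * ((n : ℝ) + 2) + 5 * (1 + √5) / 2) * a₅ (n + 1)
        + 5 * (25 + 11 * √5) / 2 * ((n : ℝ) + 1) ^ 2 * a₅ n) / ((n : ℝ) + 2) ^ 2

/-- The points of the upper half plane where `v` lies in the open disc of radius `√5 / 25`
about `0`, which reaches to the nearest nonzero singular point `-√5 / 25` of the equation below. -/
def discPreimage : Set ℂ := {τ : ℂ | 0 < τ.im ∧ ‖v τ‖ < √5 / 25}

/-- `σ` is a holomorphic branch on `Ω` of the inverse function `τ = τ(v)`. -/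
structure IsInverseBranch (Ω : Set ℂ) (σ : ℂ → ℂ) : Prop where
  isOpen : IsOpen Ω
  holomorphic : DifferentiableOn ℂ σ Ω
  im_pos : ∀ x ∈ Ω, 0 < (σ x).im
  v_apply : ∀ x ∈ Ω, v (σ x) = x

/-- At `x`, the function `y` satisfies Heun's equation with singular points
`0`, `-√5 / 25`, `(11 - 5 √5) / 2` and `∞`. -/
def HeunAt (y : ℂ → ℂ) (x : ℂ) : Prop :=
  deriv (deriv y) x
    + (1 / x + 1 / (x + (√5 : ℝ) / 25) + 1 / (x - (11 - 5 * (√5 : ℝ)) / 2)) * deriv y x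
    + (x - (15 - 7 * (√5 : ℝ)) / 10)
        / (x * (x + (√5 : ℝ) / 25) * (x - (11 - 5 * (√5 : ℝ)) / 2)) * y x = 0

end LevelFive

end

/-! Write D = q d/dq = (2πi)⁻¹ d/dτ and L = D log V. The theorem follows from a closed system: DV =
V L, DW = W (L + (W - V) U), with U a fixed linear combination of V and W, and DL = L² - V⁴ c(v)
ℓ(v). Here c is `cubic` and ℓ(x) = 5(25 + 11√5)/2 · x + 5(1 + √5)/2. It gives Dv = V² c(v), hence
c(v) dV/dv = L / V and d/dv (c dV/dv) = -ℓ V, which is Heun's equation in self-adjoint form.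

The system comes from the degenerate Fay identity `fay` for the zeta function `zetaFn`. The
derivative x d/dx of `heatFn` is q d/dq of `zetaFn`, so differentiating `fay` in x expresses
q-derivatives polynomially in zeta and ℘ values, up to ℘'. At fifth roots of unity these relations
make the ring generated by a = ζ(ε), b = ζ(ε²) and ℘(ε), with ε = `zeta5`, stable under D. The
combinations a - 3b and 3a + b have the logarithmic derivatives of the products V and W, so they are
constant multiples of them (`eisV_eq`, `eisW_eq`).

Up to constants and powers of V, the factors of c(v) are W - V, W and U. W is a convergent product
of nonzero factors; W - V and U solve homogeneous linear first order equations and are not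
identically zero. So v avoids the finite singular points and v' ≠ 0, which gives the local inverses.

For the expansion, the recurrence bounds `a₅` well enough for convergence in the disc, and the
generating function f solves the same equation. The Wronskian of V and f(v), multiplied by c(v), is
constant on the component and tends to 0 at the cusp; hence f(v)/V is constant, with limit 1. -/

noncomputable section

namespace LevelFive

open Filter Topology

/-! ### Lambert coefficients and their summability. -/

/-- The Lambert coefficient `q ^ m / (1 - q ^ m)`. -/
def lam (q : ℂ) (m : ℕ) : ℂ := q ^ m / (1 - q ^ m)

/-- The Lambert coefficient `q ^ m / (1 - q ^ m) ^ 2`. -/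
def lamSq (q : ℂ) (m : ℕ) : ℂ := q ^ m / (1 - q ^ m) ^ 2

-- Division by zero has value 0, so Lambert series may be summed from m = 0 without a correction.
@[simp] lemma lam_zero (q : ℂ) : lam q 0 = 0 := by simp [lam]

@[simp] lemma lamSq_zero (q : ℂ) : lamSq q 0 = 0 := by simp [lamSq]

lemma one_sub_pow_ne_zero {q : ℂ} (hq : ‖q‖ < 1) {m : ℕ} (hm : m ≠ 0) : 1 - q ^ m ≠ 0 := by
  intro h
  have h1 : ‖q ^ m‖ = 1 := by rw [← sub_eq_zero.mp h]; simp
  rw [norm_pow] at h1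
  exact absurd h1 (pow_lt_one₀ (norm_nonneg _) hq hm).ne

lemma one_sub_norm_le {q : ℂ} (hq : ‖q‖ < 1) {m : ℕ} (hm : m ≠ 0) :
    1 - ‖q‖ ≤ ‖1 - q ^ m‖ := by
  have h1 : ‖q ^ m‖ ≤ ‖q‖ := by
    rw [norm_pow]; exact pow_le_of_le_one (norm_nonneg _) hq.le hm
  have h2 := norm_sub_norm_le (1 : ℂ) (q ^ m)
  rw [norm_one] at h2
  linarith

lemma norm_lam_le {q : ℂ} (hq : ‖q‖ < 1) (m : ℕ) : ‖lam q m‖ ≤ 1 / (1 - ‖q‖) * ‖q‖ ^ m := by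
  have h0 : 0 < 1 - ‖q‖ := by linarith
  rcases eq_or_ne m 0 with rfl | hm
  · simp only [lam_zero, norm_zero]; positivity
  · rw [lam, norm_div, norm_pow, div_eq_mul_one_div, mul_comm]
    gcongr
    exact one_sub_norm_le hq hm

lemma norm_lamSq_le {q : ℂ} (hq : ‖q‖ < 1) (m : ℕ) :
    ‖lamSq q m‖ ≤ 1 / (1 - ‖q‖) ^ 2 * ‖q‖ ^ m := by
  have h0 : 0 < 1 - ‖q‖ := by linarith
  rcases eq_or_ne m 0 with rfl | hm
  · simp only [lamSq_zero, norm_zero]; positivity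
  · rw [lamSq, norm_div, norm_pow, norm_pow, div_eq_mul_one_div, mul_comm]
    gcongr
    exact one_sub_norm_le hq hm

lemma lamSq_eq {q : ℂ} (hq : ‖q‖ < 1) (m : ℕ) : lamSq q m = lam q m + lam q m ^ 2 := by
  rcases eq_or_ne m 0 with rfl | hm
  · simp
  · have := one_sub_pow_ne_zero hq hm
    rw [lamSq, lam]; field_simp; ring

/-- The addition formula for the hyperbolic cotangent in disguise; it trades a product of two
coefficients for terms with the summed index, and drives the collapse of double sums. -/
lemma lam_mul_lam {q : ℂ} (hq : ‖q‖ < 1) (i j : ℕ) :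
    lam q (i + 1) * lam q (j + 1)
      = lam q (i + j + 1 + 1) * (1 + lam q (i + 1) + lam q (j + 1)) := by
  have h1 := one_sub_pow_ne_zero hq i.succ_ne_zero
  have h2 := one_sub_pow_ne_zero hq j.succ_ne_zero
  have h3 := one_sub_pow_ne_zero hq (i + j + 1).succ_ne_zero
  have h4 : q ^ (i + j + 1 + 1) = q ^ (i + 1) * q ^ (j + 1) := by ring
  simp only [lam, Nat.succ_eq_add_one] at *
  rw [h4] at h3 ⊢
  generalize q ^ (i + 1) = u at *
  generalize q ^ (j + 1) = w at *
  field_simp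
  ring

lemma summable_pow_mul_of_geometric_bound {w : ℕ → ℂ} {K r : ℝ} (hr0 : 0 ≤ r) (hr : r < 1)
    (hw : ∀ m, ‖w m‖ ≤ K * r ^ m) (k : ℕ) : Summable fun m : ℕ => (m : ℝ) ^ k * ‖w m‖ := by
  have h1 : Summable fun m : ℕ => K * ((m : ℝ) ^ k * r ^ m) :=
    (summable_pow_mul_geometric_of_norm_lt_one k
      (by rwa [Real.norm_of_nonneg hr0])).mul_left K
  refine Summable.of_nonneg_of_le (fun m => by positivity) (fun m => ?_) h1
  calc (m : ℝ) ^ k * ‖w m‖ ≤ (m : ℝ) ^ k * (K * r ^ m) := by gcongr; exact hw m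
    _ = _ := by ring

lemma summable_pow_mul_lam {q : ℂ} (hq : ‖q‖ < 1) (k : ℕ) :
    Summable fun m : ℕ => (m : ℝ) ^ k * ‖lam q m‖ :=
  summable_pow_mul_of_geometric_bound (norm_nonneg q) hq (norm_lam_le hq) k

lemma summable_pow_mul_lamSq {q : ℂ} (hq : ‖q‖ < 1) (k : ℕ) :
    Summable fun m : ℕ => (m : ℝ) ^ k * ‖lamSq q m‖ :=
  summable_pow_mul_of_geometric_bound (norm_nonneg q) hq (norm_lamSq_le hq) k

/-! ### Collapse of double Lambert sums. -/

/-- The trichotomy `m < n`, `m > n`, `m = n` of pairs of natural numbers. -/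
def pairTrichotomy : (ℕ × ℕ) ⊕ (ℕ × ℕ) ⊕ ℕ ≃ ℕ × ℕ where
  toFun := Sum.elim (fun p => (p.1, p.1 + p.2 + 1))
    (Sum.elim (fun p => (p.1 + p.2 + 1, p.1)) fun m => (m, m))
  invFun p := if p.1 < p.2 then Sum.inl (p.1, p.2 - p.1 - 1)
    else if p.2 < p.1 then Sum.inr (Sum.inl (p.2, p.1 - p.2 - 1)) else Sum.inr (Sum.inr p.1)
  left_inv := by
    rintro (⟨i, j⟩ | ⟨i, j⟩ | m)
    · have : i < i + j + 1 := by omega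
      simp [this]; omega
    · have h1 : i < i + j + 1 := by omega
      have h2 : ¬ i + j + 1 < i := by omega
      simp [h1, h2]; omega
    · simp
  right_inv := by
    rintro ⟨m, n⟩
    by_cases h1 : m < n
    · simp [h1]; omega
    · by_cases h2 : n < m
      · simp [h1, h2]; omega
      · simp [h1, h2]; omega

lemma tsum_pair_trichotomy {f : ℕ × ℕ → ℂ} (hf : Summable f) :
    ∑' p, f p = ∑' p : ℕ × ℕ, f (p.1, p.1 + p.2 + 1) + ∑' p : ℕ × ℕ, f (p.1 + p.2 + 1, p.1)
      + ∑' m : ℕ, f (m, m) := by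
  have h := (pairTrichotomy.summable_iff (f := f)).mpr hf
  rw [← pairTrichotomy.tsum_eq f]
  have h1 := h.comp_injective Sum.inl_injective
  have h2 := h.comp_injective Sum.inr_injective
  have h3 := h2.comp_injective Sum.inl_injective
  have h4 := h2.comp_injective Sum.inr_injective
  have e1 := Summable.tsum_sum (f := f ∘ pairTrichotomy) h1 h2
  have e2 := Summable.tsum_sum (f := (f ∘ pairTrichotomy) ∘ Sum.inr) h3 h4
  simp only [Function.comp_def, pairTrichotomy, Equiv.coe_fn_mk, Sum.elim_inl, Sum.elim_inr]
    at e1 e2 ⊢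
  rw [e1, e2]
  ring

lemma summable_pair_of_bound {r M : ℝ} (hr0 : 0 ≤ r) (hr : r < 1) {f : ℕ × ℕ → ℂ}
    (hf : ∀ p, ‖f p‖ ≤ M * (r ^ p.1 * r ^ p.2)) : Summable f := by
  have h := summable_geometric_of_lt_one hr0 hr
  have h2 : Summable fun p : ℕ × ℕ => r ^ p.1 * r ^ p.2 :=
    h.mul_of_nonneg h (fun _ => by positivity) (fun _ => by positivity)
  exact Summable.of_norm_bounded (h2.mul_left M) hf

/-- The double sum of `G i * G j * (σ i j - δ i j)` collapses when `G` satisfies the partial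
fraction relation of the Lambert coefficients and `σ` and `δ` are compatible. -/
lemma tsum_lambert_collapse {G : ℕ → ℂ} {σ δ : ℕ → ℕ → ℂ} {r K C : ℝ}
    (hr0 : 0 ≤ r) (hr : r < 1) (hG : ∀ m, ‖G m‖ ≤ K * r ^ m)
    (hGG : ∀ i j, G i * G j = G (i + j + 1) * (1 + G i + G j))
    (hσ : ∀ i j, ‖σ i j‖ ≤ C) (hδ : ∀ i j, ‖δ i j‖ ≤ C)
    (hσδ : ∀ i j, σ i (i + j + 1) + σ (i + j + 1) i = δ i j + δ j i) :
    ∑' p : ℕ × ℕ, G p.1 * G p.2 * (σ p.1 p.2 - δ p.1 p.2)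
      = ∑' m, G m ^ 2 * σ m m
        - ∑' l, G (l + 1) * ∑ p ∈ Finset.HasAntidiagonal.antidiagonal l, δ p.1 p.2 := by
  have hK : 0 ≤ K := by have := (norm_nonneg _).trans (hG 0); simpa using this
  have hC : 0 ≤ C := (norm_nonneg _).trans (hσ 0 0)
  have hG1 : ∀ i j, ‖G (i + j + 1)‖ ≤ K * (r ^ i * r ^ j) := fun i j => by
    refine (hG _).trans ?_
    rw [← pow_add]
    exact mul_le_mul_of_nonneg_left (pow_le_pow_of_le_one hr0 hr.le (by omega)) hK
  have hG2 : ∀ i j, ‖G i * G (i + j + 1)‖ ≤ K * K * (r ^ i * r ^ j) := fun i j => by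
    rw [norm_mul]
    calc ‖G i‖ * ‖G (i + j + 1)‖ ≤ K * (K * (r ^ i * r ^ j)) := by
          gcongr
          · refine (hG i).trans ?_
            calc K * r ^ i ≤ K * 1 := by gcongr; exact pow_le_one₀ hr0 hr.le
              _ = K := mul_one K
          · exact hG1 i j
      _ = _ := by ring
  have bd : ∀ {u t : ℂ} {A B : ℝ}, ‖u‖ ≤ A → ‖t‖ ≤ C → A * C ≤ B → ‖u * t‖ ≤ B :=
    fun h1 h2 h3 => by
      rw [norm_mul]
      exact (mul_le_mul h1 h2 (norm_nonneg _) ((norm_nonneg _).trans h1)).trans h3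
  have hGp : ∀ i j, ‖G i * G j‖ ≤ K * K * (r ^ i * r ^ j) := fun i j => by
    rw [norm_mul]
    calc ‖G i‖ * ‖G j‖ ≤ (K * r ^ i) * (K * r ^ j) := by
          gcongr
          · exact hG i
          · exact hG j
      _ = _ := by ring
  have s1 : Summable fun p : ℕ × ℕ => G p.1 * G p.2 * σ p.1 p.2 :=
    summable_pair_of_bound hr0 hr (M := K * K * C) fun p => bd (hGp _ _) (hσ _ _) (by
      apply le_of_eq; ring)
  have s2 : Summable fun p : ℕ × ℕ => G p.1 * G p.2 * δ p.1 p.2 :=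
    summable_pair_of_bound hr0 hr (M := K * K * C) fun p => bd (hGp _ _) (hδ _ _) (by
      apply le_of_eq; ring)
  have s3 : Summable fun p : ℕ × ℕ => G (p.1 + p.2 + 1) * δ p.1 p.2 :=
    summable_pair_of_bound hr0 hr (M := K * C) fun p => bd (hG1 _ _) (hδ _ _) (by
      apply le_of_eq; ring)
  have s4 : Summable fun p : ℕ × ℕ => G p.1 * G (p.1 + p.2 + 1) * δ p.1 p.2 :=
    summable_pair_of_bound hr0 hr (M := K * K * C) fun p => bd (hG2 _ _) (hδ _ _) (by
      apply le_of_eq; ring)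
  have s5 : Summable fun p : ℕ × ℕ => G p.1 * G (p.1 + p.2 + 1) * δ p.2 p.1 :=
    summable_pair_of_bound hr0 hr (M := K * K * C) fun p => bd (hG2 _ _) (hδ _ _) (by
      apply le_of_eq; ring)
  have s6 : Summable fun p : ℕ × ℕ => G p.1 * G (p.1 + p.2 + 1) * σ p.1 (p.1 + p.2 + 1) :=
    summable_pair_of_bound hr0 hr (M := K * K * C) fun p => bd (hG2 _ _) (hσ _ _) (by
      apply le_of_eq; ring)
  have s7 : Summable fun p : ℕ × ℕ => G p.1 * G (p.1 + p.2 + 1) * σ (p.1 + p.2 + 1) p.1 :=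
    summable_pair_of_bound hr0 hr (M := K * K * C) fun p => bd (hG2 _ _) (hσ _ _) (by
      apply le_of_eq; ring)
  have s8 : Summable fun p : ℕ × ℕ => G p.2 * G (p.1 + p.2 + 1) * δ p.1 p.2 := by
    refine ((Equiv.prodComm ℕ ℕ).summable_iff.mpr s5).congr fun p => ?_
    simp [add_comm p.1 p.2]
  -- For σ: split into the diagonal and the two triangles, whose σ-values combine by `hσδ`.
  have e1 : ∑' p : ℕ × ℕ, G p.1 * G p.2 * σ p.1 p.2
      = ∑' p : ℕ × ℕ, G p.1 * G (p.1 + p.2 + 1) * (δ p.1 p.2 + δ p.2 p.1)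
        + ∑' m, G m ^ 2 * σ m m := by
    rw [tsum_pair_trichotomy s1]
    congr 1
    · rw [← Summable.tsum_add s6 (by simpa only [mul_comm] using s7)]
      refine tsum_congr fun p => ?_
      rw [← hσδ]; ring
    · exact tsum_congr fun m => by ring
  have e2 : ∑' p : ℕ × ℕ, G p.2 * G (p.1 + p.2 + 1) * δ p.1 p.2
      = ∑' p : ℕ × ℕ, G p.1 * G (p.1 + p.2 + 1) * δ p.2 p.1 := by
    rw [← (Equiv.prodComm ℕ ℕ).tsum_eq]
    refine tsum_congr fun p => ?_
    simp [add_comm p.1 p.2]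
  -- For δ: the relation `hGG` produces the same off-diagonal quadratic sum, which therefore cancels
  -- and leaves only single sums.
  have e3 : ∑' p : ℕ × ℕ, G p.1 * G p.2 * δ p.1 p.2
      = ∑' p : ℕ × ℕ, G (p.1 + p.2 + 1) * δ p.1 p.2
        + ∑' p : ℕ × ℕ, G p.1 * G (p.1 + p.2 + 1) * (δ p.1 p.2 + δ p.2 p.1) := by
    have : ∀ p : ℕ × ℕ, G p.1 * G p.2 * δ p.1 p.2
        = G (p.1 + p.2 + 1) * δ p.1 p.2 + G p.1 * G (p.1 + p.2 + 1) * δ p.1 p.2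
          + G p.2 * G (p.1 + p.2 + 1) * δ p.1 p.2 := fun p => by rw [hGG]; ring
    rw [tsum_congr this, Summable.tsum_add (s3.add s4) s8, Summable.tsum_add s3 s4, e2, add_assoc,
      ← Summable.tsum_add s4 s5]
    congr 1
    exact tsum_congr fun p => by ring
  have e4 : ∑' p : ℕ × ℕ, G (p.1 + p.2 + 1) * δ p.1 p.2
      = ∑' l, G (l + 1) * ∑ p ∈ Finset.HasAntidiagonal.antidiagonal l, δ p.1 p.2 := by
    have s9 := Finset.HasAntidiagonal.sigmaAntidiagonalEquivProd.summable_iff.mpr s3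
    have e := Summable.tsum_sigma' (fun l => (hasSum_fintype _).summable) s9
    simp only [Function.comp_def] at e
    rw [← Finset.HasAntidiagonal.sigmaAntidiagonalEquivProd.tsum_eq, e]
    refine tsum_congr fun l => ?_
    rw [tsum_fintype, Finset.mul_sum, ← Finset.sum_coe_sort (Finset.HasAntidiagonal.antidiagonal l)]
    refine Finset.sum_congr rfl fun p _ => ?_
    have := Finset.HasAntidiagonal.mem_antidiagonal.mp p.2
    simp [Finset.HasAntidiagonal.sigmaAntidiagonalEquivProd, this]
  have e5 : ∑' p : ℕ × ℕ, G p.1 * G p.2 * (σ p.1 p.2 - δ p.1 p.2)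
      = ∑' p : ℕ × ℕ, G p.1 * G p.2 * σ p.1 p.2 - ∑' p : ℕ × ℕ, G p.1 * G p.2 * δ p.1 p.2 := by
    rw [← Summable.tsum_sub s1 s2]
    exact tsum_congr fun p => by ring
  rw [e5, e1, e3, e4]
  ring

/-! ### The zeta function and the degenerate Fay identity. -/

/-- The series `∑ w m * (x ^ m - x ^ (-m))`. -/
def oddSeries (w : ℕ → ℂ) (x : ℂ) : ℂ := ∑' m, w m * (x ^ m - x⁻¹ ^ m)

/-- The series `∑ w m * (x ^ m + x ^ (-m))`. -/
def evenSeries (w : ℕ → ℂ) (x : ℂ) : ℂ := ∑' m, w m * (x ^ m + x⁻¹ ^ m)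

/-- The quasi-elliptic zeta function in the multiplicative variable `x`. -/
def zetaFn (q x : ℂ) : ℂ := (1 + x) / (2 * (1 - x)) + oddSeries (lam q) x

/-- The logarithmic `x`-derivative `x d/dx` of `zetaFn`. -/
def wpFn (q x : ℂ) : ℂ := x / (1 - x) ^ 2 + evenSeries (fun m => m * lam q m) x

/-- The logarithmic `x`-derivative `x d/dx` of `wpFn`. -/
def wpFn' (q x : ℂ) : ℂ :=
  x * (1 + x) / (1 - x) ^ 3 + oddSeries (fun m => m * (m * lam q m)) x

/-- The series `∑ q ^ m / (1 - q ^ m) ^ 2 * (x ^ m + x ^ (-m))`. -/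
def heatFn (q x : ℂ) : ℂ := evenSeries (lamSq q) x

lemma summable_odd {w : ℕ → ℂ} (hw : Summable fun m => ‖w m‖) {x : ℂ} (hx : ‖x‖ = 1) :
    Summable fun m => ‖w m * (x ^ m - x⁻¹ ^ m)‖ := by
  refine Summable.of_nonneg_of_le (fun m => norm_nonneg _) (fun m => ?_) (hw.mul_right 2)
  rw [norm_mul]
  gcongr
  refine (norm_sub_le _ _).trans ?_
  simp [hx]; norm_num

lemma summable_even {w : ℕ → ℂ} (hw : Summable fun m => ‖w m‖) {x : ℂ} (hx : ‖x‖ = 1) :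
    Summable fun m => ‖w m * (x ^ m + x⁻¹ ^ m)‖ := by
  refine Summable.of_nonneg_of_le (fun m => norm_nonneg _) (fun m => ?_) (hw.mul_right 2)
  rw [norm_mul]
  gcongr
  refine (norm_add_le _ _).trans ?_
  simp [hx]; norm_num

lemma summable_norm_lam {q : ℂ} (hq : ‖q‖ < 1) : Summable fun m => ‖lam q m‖ := by
  simpa using summable_pow_mul_lam hq 0

lemma summable_norm_lamSq {q : ℂ} (hq : ‖q‖ < 1) : Summable fun m => ‖lamSq q m‖ := by
  simpa using summable_pow_mul_lamSq hq 0

lemma oddSeries_lam_succ {q : ℂ} (hq : ‖q‖ < 1) {x : ℂ} (hx : ‖x‖ = 1) :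
    oddSeries (lam q) x = ∑' m, lam q (m + 1) * (x ^ (m + 1) - x⁻¹ ^ (m + 1)) := by
  rw [oddSeries, (summable_odd (summable_norm_lam hq) hx).of_norm.tsum_eq_zero_add]
  simp

lemma mul_sum_range_geom (x y : ℂ) (m : ℕ) :
    (x - y) * ∑ i ∈ Finset.range m, x ^ (i + 1) * y ^ (m - 1 - i + 1)
      = x * y * (x ^ m - y ^ m) := by
  rw [← geom_sum₂_mul, Finset.mul_sum, Finset.sum_mul, Finset.mul_sum]
  exact Finset.sum_congr rfl fun i _ => by ring

/-- The closed form of `∑ x ^ i * y ^ (-j)` over `i + j = m + 1`, `i, j ≥ 1`, for `x y z = 1`. -/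
lemma sum_range_geom_eq {x y z : ℂ} (hxyz : x * y * z = 1) (hz : z ≠ 1) (m : ℕ) :
    ∑ i ∈ Finset.range m, x ^ (i + 1) * y⁻¹ ^ (m - 1 - i + 1)
      = x ^ (m + 1) * ((1 + z) / (2 * (1 - z)) - 1 / 2)
        - y⁻¹ ^ (m + 1) * ((1 + z) / (2 * (1 - z)) + 1 / 2) := by
  have hx : x ≠ 0 := by rintro rfl; simp at hxyz
  have hy : y ≠ 0 := by rintro rfl; simp at hxyz
  have hz0 : z ≠ 0 := by rintro rfl; simp at hxyz
  have h1 : 1 - z ≠ 0 := sub_ne_zero.mpr hz.symm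
  have hyz : y⁻¹ = x * z := by field_simp; rw [← hxyz]; ring
  have hne : x - y⁻¹ ≠ 0 := by
    rw [hyz, show x - x * z = x * (1 - z) by ring]; exact mul_ne_zero hx h1
  apply mul_left_cancel₀ hne
  rw [mul_sum_range_geom, pow_succ, pow_succ, hyz]
  generalize (x * z) ^ m = u
  field_simp
  ring

/-- The case q = 0 of `fay`: for x = exp(iθ) each factor is (i/2) cot(θ/2), and the cotangents of
three angles with sum in πℤ satisfy cot cot + cot cot + cot cot = 1. -/
lemma coth_product_sum {x y z : ℂ} (hxyz : x * y * z = 1) (hx : x ≠ 1) (hy : y ≠ 1) (hz : z ≠ 1) :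
    (1 + x) / (2 * (1 - x)) * ((1 + y) / (2 * (1 - y)))
      + (1 + y) / (2 * (1 - y)) * ((1 + z) / (2 * (1 - z)))
      + (1 + z) / (2 * (1 - z)) * ((1 + x) / (2 * (1 - x))) = -1 / 4 := by
  have h1 : 1 - x ≠ 0 := sub_ne_zero.mpr hx.symm
  have h2 : 1 - y ≠ 0 := sub_ne_zero.mpr hy.symm
  have h3 : 1 - z ≠ 0 := sub_ne_zero.mpr hz.symm
  field_simp
  linear_combination (-16 : ℂ) * hxyz

section Fay

variable {q x y z : ℂ}

/-- The monomials of `S(x) S(y) + S(y) S(z) + S(z) S(x)` with exponents of equal sign. -/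
def sameSign (x y z : ℂ) (i j : ℕ) : ℂ :=
  (x ^ (i + 1) * y ^ (j + 1) + x⁻¹ ^ (i + 1) * y⁻¹ ^ (j + 1))
    + (y ^ (i + 1) * z ^ (j + 1) + y⁻¹ ^ (i + 1) * z⁻¹ ^ (j + 1))
    + (z ^ (i + 1) * x ^ (j + 1) + z⁻¹ ^ (i + 1) * x⁻¹ ^ (j + 1))

/-- The monomials of `S(x) S(y) + S(y) S(z) + S(z) S(x)` with exponents of opposite sign. -/
def oppositeSign (x y z : ℂ) (i j : ℕ) : ℂ :=
  (x ^ (i + 1) * y⁻¹ ^ (j + 1) + y ^ (j + 1) * x⁻¹ ^ (i + 1))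
    + (y ^ (i + 1) * z⁻¹ ^ (j + 1) + z ^ (j + 1) * y⁻¹ ^ (i + 1))
    + (z ^ (i + 1) * x⁻¹ ^ (j + 1) + x ^ (j + 1) * z⁻¹ ^ (i + 1))

lemma norm_sameSign_le (hx : ‖x‖ = 1) (hy : ‖y‖ = 1) (hz : ‖z‖ = 1) (i j : ℕ) :
    ‖sameSign x y z i j‖ ≤ 6 := by
  unfold sameSign
  refine (norm_add₃_le.trans (add_le_add_three (norm_add_le _ _) (norm_add_le _ _)
    (norm_add_le _ _))).trans ?_
  simp [hx, hy, hz]; norm_num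

lemma norm_oppositeSign_le (hx : ‖x‖ = 1) (hy : ‖y‖ = 1) (hz : ‖z‖ = 1) (i j : ℕ) :
    ‖oppositeSign x y z i j‖ ≤ 6 := by
  unfold oppositeSign
  refine (norm_add₃_le.trans (add_le_add_three (norm_add_le _ _) (norm_add_le _ _)
    (norm_add_le _ _))).trans ?_
  simp [hx, hy, hz]; norm_num

/-- Since xy = 1/z, a monomial such as x^(i+1) y^(i+j+2) equals z^(-(i+1)) y^(j+1). This is the
compatibility `hσδ` of `tsum_lambert_collapse`. -/
lemma sameSign_add_sameSign (hxyz : x * y * z = 1) (i j : ℕ) :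
    sameSign x y z i (i + j + 1) + sameSign x y z (i + j + 1) i
      = oppositeSign x y z i j + oppositeSign x y z j i := by
  have hx : x ≠ 0 := by rintro rfl; simp at hxyz
  have hy : y ≠ 0 := by rintro rfl; simp at hxyz
  obtain rfl : z = x⁻¹ * y⁻¹ := by
    field_simp; linear_combination hxyz
  simp only [sameSign, oppositeSign, mul_pow, mul_inv, inv_inv, inv_pow]
  rw [show i + j + 1 + 1 = (i + 1) + (j + 1) by ring]
  simp only [pow_add _ (i + 1) (j + 1)]
  have hu := pow_ne_zero (i + 1) hx
  have hv := pow_ne_zero (j + 1) hx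
  have hu' := pow_ne_zero (i + 1) hy
  have hv' := pow_ne_zero (j + 1) hy
  generalize x ^ (i + 1) = a at *
  generalize x ^ (j + 1) = b at *
  generalize y ^ (i + 1) = c at *
  generalize y ^ (j + 1) = d at *
  field_simp
  ring

lemma sameSign_diag (hxyz : x * y * z = 1) (m : ℕ) :
    sameSign x y z m m = (x ^ (m + 1) + x⁻¹ ^ (m + 1)) + (y ^ (m + 1) + y⁻¹ ^ (m + 1))
      + (z ^ (m + 1) + z⁻¹ ^ (m + 1)) := by
  have hx : x ≠ 0 := by rintro rfl; simp at hxyz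
  have hy : y ≠ 0 := by rintro rfl; simp at hxyz
  obtain rfl : z = x⁻¹ * y⁻¹ := by
    field_simp; linear_combination hxyz
  simp only [sameSign, ← mul_pow]
  field_simp
  ring

/-- Geometric sums with ratios x, y, z up to inversion. The odd part is what the products of
cotangent terms with Lambert series contribute to `fay`; the even part remains. -/
lemma sum_oppositeSign (hxyz : x * y * z = 1) (hx : x ≠ 1) (hy : y ≠ 1) (hz : z ≠ 1) (m : ℕ) :
    ∑ i ∈ Finset.range m, oppositeSign x y z i (m - 1 - i)
      = (1 + x) / (2 * (1 - x)) * ((y ^ (m + 1) - y⁻¹ ^ (m + 1)) + (z ^ (m + 1) - z⁻¹ ^ (m + 1)))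
      + (1 + y) / (2 * (1 - y)) * ((z ^ (m + 1) - z⁻¹ ^ (m + 1)) + (x ^ (m + 1) - x⁻¹ ^ (m + 1)))
      + (1 + z) / (2 * (1 - z)) * ((x ^ (m + 1) - x⁻¹ ^ (m + 1)) + (y ^ (m + 1) - y⁻¹ ^ (m + 1)))
      - ((x ^ (m + 1) + x⁻¹ ^ (m + 1)) + (y ^ (m + 1) + y⁻¹ ^ (m + 1))
        + (z ^ (m + 1) + z⁻¹ ^ (m + 1))) := by
  have flip : ∀ a b : ℂ, ∑ i ∈ Finset.range m, b ^ (m - 1 - i + 1) * a⁻¹ ^ (i + 1)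
      = ∑ i ∈ Finset.range m, b ^ (i + 1) * a⁻¹ ^ (m - 1 - i + 1) := fun a b => by
    rw [← Finset.sum_range_reflect]
    refine Finset.sum_congr rfl fun i hi => ?_
    have : m - 1 - (m - 1 - i) = i := by have := Finset.mem_range.mp hi; omega
    rw [this]
  simp only [oppositeSign, Finset.sum_add_distrib, flip]
  rw [sum_range_geom_eq hxyz hz, sum_range_geom_eq (by rw [← hxyz]; ring : y * x * z = 1) hz,
    sum_range_geom_eq (by rw [← hxyz]; ring : y * z * x = 1) hx,
    sum_range_geom_eq (by rw [← hxyz]; ring : z * y * x = 1) hx,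
    sum_range_geom_eq (by rw [← hxyz]; ring : z * x * y = 1) hy,
    sum_range_geom_eq (by rw [← hxyz]; ring : x * z * y = 1) hy]
  ring

/-- The three-term relation of the zeta function: the degenerate Fay identity. -/
theorem fay (hq : ‖q‖ < 1) (nx : ‖x‖ = 1) (ny : ‖y‖ = 1) (nz : ‖z‖ = 1) (hxyz : x * y * z = 1)
    (hx : x ≠ 1) (hy : y ≠ 1) (hz : z ≠ 1) :
    zetaFn q x * zetaFn q y + zetaFn q y * zetaFn q z + zetaFn q z * zetaFn q x
      = -1 / 4 + heatFn q x + heatFn q y + heatFn q z := by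
  set G : ℕ → ℂ := fun m => lam q (m + 1) with hG
  set E : ℕ → ℂ := fun m => ∑ i ∈ Finset.range m, oppositeSign x y z i (m - 1 - i) with hE
  have hr0 := norm_nonneg q
  have hGb : ∀ m, ‖G m‖ ≤ 1 / (1 - ‖q‖) * ‖q‖ ^ m := fun m => by
    refine (norm_lam_le hq (m + 1)).trans ?_
    have : 0 < 1 - ‖q‖ := by linarith
    have := pow_le_pow_of_le_one hr0 hq.le m.le_succ
    gcongr
  have col := tsum_lambert_collapse (δ := oppositeSign x y z) hr0 hq hGb (lam_mul_lam hq)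
    (norm_sameSign_le nx ny nz) (norm_oppositeSign_le nx ny nz) (sameSign_add_sameSign hxyz)
  have hGs : Summable fun m => ‖G m‖ := by
    simpa using summable_pow_mul_of_geometric_bound hr0 hq hGb 0
  have sE : Summable fun m => G m * E m := by
    refine Summable.of_norm_bounded
      ((summable_pow_mul_of_geometric_bound hr0 hq hGb 1).mul_right 6) fun m => ?_
    have : ‖E m‖ ≤ m * 6 := by
      refine (norm_sum_le _ _).trans ?_
      refine (Finset.sum_le_card_nsmul _ _ 6 fun i _ => norm_oppositeSign_le nx ny nz _ _).trans ?_
      simp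
    rw [norm_mul]
    calc ‖G m‖ * ‖E m‖ ≤ ‖G m‖ * (m * 6) := by gcongr
      _ = _ := by ring
  -- The sum `E 0` is empty, so `E` may be indexed like `G`, with `E (l + 1)` the antidiagonal sum
  -- at l.
  have eE : ∑' l, G (l + 1) * ∑ p ∈ Finset.HasAntidiagonal.antidiagonal l,
      oppositeSign x y z p.1 p.2 = ∑' m, G m * E m := by
    rw [sE.tsum_eq_zero_add]
    simp only [hE, Finset.range_zero, Finset.sum_empty, mul_zero, zero_add]
    refine tsum_congr fun l => ?_
    rw [Finset.Nat.sum_antidiagonal_eq_sum_range_succ_mk]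
    simp
  have so : ∀ {t : ℂ}, ‖t‖ = 1 → Summable fun m => ‖G m * (t ^ (m + 1) - t⁻¹ ^ (m + 1))‖ :=
    fun ht => (summable_nat_add_iff 1).mpr (summable_odd (summable_norm_lam hq) ht)
  have prod : ∀ {s t : ℂ}, ‖s‖ = 1 → ‖t‖ = 1 → HasSum (fun p : ℕ × ℕ =>
      (G p.1 * (s ^ (p.1 + 1) - s⁻¹ ^ (p.1 + 1))) * (G p.2 * (t ^ (p.2 + 1) - t⁻¹ ^ (p.2 + 1))))
      (oddSeries (lam q) s * oddSeries (lam q) t) := fun hs ht => by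
    rw [oddSeries_lam_succ hq hs, oddSeries_lam_succ hq ht,
      tsum_mul_tsum_of_summable_norm (so hs) (so ht)]
    exact (summable_mul_of_summable_norm (so hs) (so ht)).hasSum
  have T := ((prod nx ny).add (prod ny nz)).add (prod nz nx)
  have T' : oddSeries (lam q) x * oddSeries (lam q) y + oddSeries (lam q) y * oddSeries (lam q) z
      + oddSeries (lam q) z * oddSeries (lam q) x
      = ∑' m, G m ^ 2 * sameSign x y z m m - ∑' m, G m * E m := by
    rw [← T.tsum_eq, ← eE, ← col]
    refine tsum_congr fun p => ?_
    simp only [sameSign, oppositeSign]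
    ring
  have heat : ∀ {t : ℂ}, ‖t‖ = 1 →
      HasSum (fun m => lamSq q (m + 1) * (t ^ (m + 1) + t⁻¹ ^ (m + 1))) (heatFn q t) := fun ht => by
    have h1 := (summable_even (summable_norm_lamSq hq) ht).of_norm
    have h2 := h1.tsum_eq_zero_add
    rw [heatFn, evenSeries, h2]
    simpa using ((summable_nat_add_iff 1).mpr h1).hasSum
  have odd : ∀ {t : ℂ}, ‖t‖ = 1 →
      HasSum (fun m => G m * (t ^ (m + 1) - t⁻¹ ^ (m + 1))) (oddSeries (lam q) t) := fun ht => by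
    rw [oddSeries_lam_succ hq ht]; exact (so ht).of_norm.hasSum
  have sσ : Summable fun m => G m ^ 2 * sameSign x y z m m := by
    refine Summable.of_norm_bounded
      (hGs.mul_right (1 / (1 - ‖q‖) * 6)) fun m => ?_
    rw [norm_mul, norm_pow, sq, mul_assoc]
    have h0 : 0 < 1 - ‖q‖ := by linarith
    gcongr
    · refine (hGb m).trans ?_
      exact mul_le_of_le_one_right (by positivity) (pow_le_one₀ hr0 hq.le)
    · exact norm_sameSign_le nx ny nz m m
  have key := ((((odd ny).add (odd nz)).mul_left ((1 + x) / (2 * (1 - x)))).add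
    (((odd nz).add (odd nx)).mul_left ((1 + y) / (2 * (1 - y))))).add
    (((odd nx).add (odd ny)).mul_left ((1 + z) / (2 * (1 - z))))
  -- Termwise the odd parts cancel, and the even parts carry the coefficient λ + λ², which is
  -- `lamSq`.
  have tot := ((key.add sσ.hasSum).sub sE.hasSum).unique
    ((((heat nx).add (heat ny)).add (heat nz)).congr_fun (fun m => by
      simp only [hE, sum_oppositeSign hxyz hx hy hz, sameSign_diag hxyz, lamSq_eq hq, hG]
      ring))
  have c := coth_product_sum hxyz hx hy hz
  simp only [zetaFn]
  linear_combination T' + tot + c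

end Fay

/-! ### Derivatives along the unit circle and the consequences of the Fay identity. -/

/-- The point `exp (i s)` of the unit circle. -/
def circ (s : ℝ) : ℂ := Complex.exp (Complex.I * s)

lemma norm_circ (s : ℝ) : ‖circ s‖ = 1 := by
  rw [circ, mul_comm, Complex.norm_exp_ofReal_mul_I]

lemma circ_ne_zero (s : ℝ) : circ s ≠ 0 := Complex.exp_ne_zero _

lemma circ_add (s t : ℝ) : circ (s + t) = circ s * circ t := by
  simp only [circ, ← Complex.exp_add]; push_cast; ring_nf

lemma circ_neg (s : ℝ) : circ (-s) = (circ s)⁻¹ := by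
  simp only [circ, ← Complex.exp_neg]; push_cast; ring_nf

lemma circ_zero : circ 0 = 1 := by simp [circ]

lemma circ_pow (s : ℝ) (m : ℕ) : circ s ^ m = Complex.exp (Complex.I * m * s) := by
  rw [circ, ← Complex.exp_nat_mul]; ring_nf

lemma hasDerivAt_circ (s : ℝ) : HasDerivAt circ (Complex.I * circ s) s := by
  have h1 : HasDerivAt (fun s : ℝ => Complex.I * (s : ℂ)) (Complex.I * 1) s :=
    Complex.ofRealCLM.hasDerivAt.const_mul Complex.I
  have h2 := h1.cexp
  simp only [mul_one] at h2
  rw [mul_comm]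
  exact h2

lemma hasDerivAt_circ_pow (m : ℕ) (s : ℝ) :
    HasDerivAt (fun s => circ s ^ m) (Complex.I * (m * circ s ^ m)) s := by
  rcases m with _ | m
  · simpa using hasDerivAt_const s (1 : ℂ)
  · refine ((hasDerivAt_circ s).fun_pow (m + 1)).congr_deriv ?_
    rw [Nat.add_sub_cancel]
    ring

lemma hasDerivAt_circ_inv_pow (m : ℕ) (s : ℝ) :
    HasDerivAt (fun s => (circ s)⁻¹ ^ m) (-(Complex.I * (m * (circ s)⁻¹ ^ m))) s := by
  have h := (hasDerivAt_circ_pow m (-s)).scomp s (hasDerivAt_neg s)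
  simp only [Function.comp_def, circ_neg, neg_smul, one_smul] at h
  exact h

lemma hasDerivAt_oddSeries {w : ℕ → ℂ} (hw : Summable fun m : ℕ => (m : ℝ) * ‖w m‖) (s : ℝ) :
    HasDerivAt (fun s => oddSeries w (circ s))
      (Complex.I * evenSeries (fun m => m * w m) (circ s)) s := by
  have h := hasDerivAt_tsum (hw.mul_right 2)
    (g := fun (m : ℕ) s => w m * (circ s ^ m - (circ s)⁻¹ ^ m))
    (g' := fun (m : ℕ) s => Complex.I * (m * w m * (circ s ^ m + (circ s)⁻¹ ^ m)))
    (fun m s => by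
      refine (((hasDerivAt_circ_pow m s).fun_sub (hasDerivAt_circ_inv_pow m s)).const_mul
        (w m)).congr_deriv ?_
      ring)
    (fun m s => by
      rw [norm_mul, norm_mul, norm_mul, Complex.norm_I, one_mul, Complex.norm_natCast]
      gcongr
      refine (norm_add_le _ _).trans ?_
      simp [norm_circ]; norm_num)
    (y₀ := 0) (by simp [circ_zero]) s
  rw [tsum_mul_left] at h
  exact h

lemma hasDerivAt_evenSeries {w : ℕ → ℂ} (hw0 : Summable fun m : ℕ => ‖w m‖)
    (hw : Summable fun m : ℕ => (m : ℝ) * ‖w m‖) (s : ℝ) :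
    HasDerivAt (fun s => evenSeries w (circ s))
      (Complex.I * oddSeries (fun m => m * w m) (circ s)) s := by
  have h := hasDerivAt_tsum (hw.mul_right 2)
    (g := fun (m : ℕ) s => w m * (circ s ^ m + (circ s)⁻¹ ^ m))
    (g' := fun (m : ℕ) s => Complex.I * (m * w m * (circ s ^ m - (circ s)⁻¹ ^ m)))
    (fun m s => by
      refine (((hasDerivAt_circ_pow m s).fun_add (hasDerivAt_circ_inv_pow m s)).const_mul
        (w m)).congr_deriv ?_
      ring)
    (fun m s => by
      rw [norm_mul, norm_mul, norm_mul, Complex.norm_I, one_mul, Complex.norm_natCast]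
      gcongr
      refine (norm_sub_le _ _).trans ?_
      simp [norm_circ]; norm_num)
    (y₀ := 0) (summable_even hw0 (norm_circ 0)).of_norm s
  rw [tsum_mul_left] at h
  exact h

/-- The series `∑ m * q ^ m / (1 - q ^ m) ^ 2 * (x ^ m - x ^ (-m))`. -/
def zetaFnD (q x : ℂ) : ℂ := oddSeries (fun m => m * lamSq q m) x

/-- The series `∑ m ^ 2 * q ^ m / (1 - q ^ m) ^ 2 * (x ^ m + x ^ (-m))`. -/
def wpFnD (q x : ℂ) : ℂ := evenSeries (fun m => m * (m * lamSq q m)) x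

lemma oddSeries_inv (w : ℕ → ℂ) (x : ℂ) : oddSeries w x⁻¹ = -oddSeries w x := by
  simp only [oddSeries, inv_inv, ← tsum_neg]
  exact tsum_congr fun m => by ring

lemma evenSeries_inv (w : ℕ → ℂ) (x : ℂ) : evenSeries w x⁻¹ = evenSeries w x := by
  simp only [evenSeries, inv_inv, add_comm]

lemma zetaFn_inv (q : ℂ) {x : ℂ} (h0 : x ≠ 0) (hx : x ≠ 1) : zetaFn q x⁻¹ = -zetaFn q x := by
  have h1 : 1 - x ≠ 0 := sub_ne_zero.mpr hx.symm
  have h2 : x - 1 ≠ 0 := sub_ne_zero.mpr hx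
  have h3 : 1 - x⁻¹ ≠ 0 := by
    rw [show 1 - x⁻¹ = (x - 1) * x⁻¹ by field_simp]; exact mul_ne_zero h2 (inv_ne_zero h0)
  have e : (1 + x⁻¹) / (2 * (1 - x⁻¹)) = -((1 + x) / (2 * (1 - x))) := by
    field_simp; ring
  rw [zetaFn, zetaFn, oddSeries_inv, e]; ring

lemma wpFn_inv (q : ℂ) {x : ℂ} (h0 : x ≠ 0) (hx : x ≠ 1) : wpFn q x⁻¹ = wpFn q x := by
  have h1 : 1 - x ≠ 0 := sub_ne_zero.mpr hx.symm
  have h2 : x - 1 ≠ 0 := sub_ne_zero.mpr hx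
  have h3 : 1 - x⁻¹ ≠ 0 := by
    rw [show 1 - x⁻¹ = (x - 1) * x⁻¹ by field_simp]; exact mul_ne_zero h2 (inv_ne_zero h0)
  have e : x⁻¹ / (1 - x⁻¹) ^ 2 = x / (1 - x) ^ 2 := by
    field_simp; ring
  rw [wpFn, wpFn, evenSeries_inv, e]

section

variable {q : ℂ} (hq : ‖q‖ < 1)
include hq

lemma hasDerivAt_zetaFn {s : ℝ} (hs : circ s ≠ 1) :
    HasDerivAt (fun s => zetaFn q (circ s)) (Complex.I * wpFn q (circ s)) s := by
  have h1 : 1 - circ s ≠ 0 := sub_ne_zero.mpr hs.symm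
  have hc := hasDerivAt_circ s
  have h := ((hc.const_add 1).div ((hc.const_sub 1).const_mul 2)
    (mul_ne_zero two_ne_zero h1)).add
    (hasDerivAt_oddSeries (w := lam q) (by simpa using summable_pow_mul_lam hq 1) s)
  refine h.congr_deriv ?_
  rw [wpFn]
  field_simp
  ring

lemma hasDerivAt_wpFn {s : ℝ} (hs : circ s ≠ 1) :
    HasDerivAt (fun s => wpFn q (circ s)) (Complex.I * wpFn' q (circ s)) s := by
  have h1 : 1 - circ s ≠ 0 := sub_ne_zero.mpr hs.symm
  have hc := hasDerivAt_circ s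
  have h := (hc.div ((hc.const_sub 1).fun_pow 2) (pow_ne_zero 2 h1)).add
    (hasDerivAt_evenSeries (w := fun m => m * lam q m)
      (by simpa using summable_pow_mul_lam hq 1)
      (by simpa [← mul_assoc, sq] using summable_pow_mul_lam hq 2) s)
  refine h.congr_deriv ?_
  rw [wpFn']
  field_simp
  ring

/-- The result `zetaFnD` is also q d/dq of `zetaFn` (see `hasDerivAt_zetaFn_nome`): this double role
turns x-derivatives of `fay` into statements about q-derivatives. -/
lemma hasDerivAt_heatFn (s : ℝ) :
    HasDerivAt (fun s => heatFn q (circ s)) (Complex.I * zetaFnD q (circ s)) s :=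
  hasDerivAt_evenSeries (summable_norm_lamSq hq) (by simpa using summable_pow_mul_lamSq hq 1) s

lemma hasDerivAt_zetaFnD (s : ℝ) :
    HasDerivAt (fun s => zetaFnD q (circ s)) (Complex.I * wpFnD q (circ s)) s :=
  hasDerivAt_oddSeries (by simpa [← mul_assoc, sq] using summable_pow_mul_lamSq hq 2) s

omit hq in
lemma eventually_circ_ne_one {s : ℝ} (hs : circ s ≠ 1) : ∀ᶠ u in 𝓝 s, circ u ≠ 1 :=
  (hasDerivAt_circ s).continuousAt.eventually_ne hs

omit hq in
lemma eventually_circ_neg_ne_one {s t : ℝ} (hs : circ (-(s + t)) ≠ 1) :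
    ∀ᶠ u in 𝓝 s, circ (-(u + t)) ≠ 1 := by
  have h : ContinuousAt (fun u => circ (-(u + t))) s := by
    unfold circ; fun_prop
  exact h.eventually_ne hs

omit hq in
lemma hasDerivAt_comp_neg_add {f : ℝ → ℂ} {f' : ℂ} {s t : ℝ} (h : HasDerivAt f f' (-(s + t))) :
    HasDerivAt (fun u => f (-(u + t))) (-f') s := by
  have := h.scomp s (((hasDerivAt_id' s).add_const t).fun_neg)
  rwa [neg_one_smul] at this

lemma fay_circ {s t : ℝ} (hs : circ s ≠ 1) (ht : circ t ≠ 1) (hst : circ (-(s + t)) ≠ 1) :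
    zetaFn q (circ s) * zetaFn q (circ t) + zetaFn q (circ t) * zetaFn q (circ (-(s + t)))
      + zetaFn q (circ (-(s + t))) * zetaFn q (circ s)
      = -1 / 4 + heatFn q (circ s) + heatFn q (circ t) + heatFn q (circ (-(s + t))) :=
  fay hq (norm_circ s) (norm_circ t) (norm_circ _)
    (by rw [← circ_add, ← circ_add]; simp [circ_zero]) hs ht hst

/-- The s-derivative of `fay_circ` with t fixed: y is constant while x and z = 1/(xy) move in
opposite directions, whence the signs. -/
lemma fay_deriv {s t : ℝ} (hs : circ s ≠ 1) (ht : circ t ≠ 1) (hst : circ (-(s + t)) ≠ 1) :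
    wpFn q (circ s) * (zetaFn q (circ t) + zetaFn q (circ (-(s + t))))
      - wpFn q (circ (-(s + t))) * (zetaFn q (circ s) + zetaFn q (circ t))
      = zetaFnD q (circ s) - zetaFnD q (circ (-(s + t))) := by
  have dx := hasDerivAt_zetaFn hq hs
  have dz := hasDerivAt_comp_neg_add (hasDerivAt_zetaFn hq hst)
  have px := hasDerivAt_heatFn hq s
  have pz := hasDerivAt_comp_neg_add (hasDerivAt_heatFn hq (-(s + t)))
  have l := ((dx.mul_const (zetaFn q (circ t))).add (dz.const_mul (zetaFn q (circ t)))).add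
    (dz.mul dx)
  have r := ((px.const_add (-1 / 4)).add_const (heatFn q (circ t))).add pz
  have := l.unique (r.congr_of_eventuallyEq (by
    filter_upwards [eventually_circ_ne_one hs, eventually_circ_neg_ne_one hst] with u h1 h2
    exact fay_circ hq h1 ht h2))
  apply mul_left_cancel₀ Complex.I_ne_zero
  linear_combination this

lemma fay_deriv_deriv {s t : ℝ} (hs : circ s ≠ 1) (ht : circ t ≠ 1) (hst : circ (-(s + t)) ≠ 1) :
    wpFn' q (circ s) * (zetaFn q (circ t) + zetaFn q (circ (-(s + t))))
      + wpFn' q (circ (-(s + t))) * (zetaFn q (circ s) + zetaFn q (circ t))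
      - 2 * wpFn q (circ s) * wpFn q (circ (-(s + t)))
      = wpFnD q (circ s) + wpFnD q (circ (-(s + t))) := by
  have dx := hasDerivAt_zetaFn hq hs
  have dz := hasDerivAt_comp_neg_add (hasDerivAt_zetaFn hq hst)
  have ax := hasDerivAt_wpFn hq hs
  have az := hasDerivAt_comp_neg_add (hasDerivAt_wpFn hq hst)
  have px := hasDerivAt_zetaFnD hq s
  have pz := hasDerivAt_comp_neg_add (hasDerivAt_zetaFnD hq (-(s + t)))
  have l := (ax.mul (dz.const_add (zetaFn q (circ t)))).sub
    (az.mul (dx.add_const (zetaFn q (circ t))))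
  have r := px.sub pz
  have := l.unique (r.congr_of_eventuallyEq (by
    filter_upwards [eventually_circ_ne_one hs, eventually_circ_neg_ne_one hst] with u h1 h2
    exact fay_deriv hq h1 ht h2))
  apply mul_left_cancel₀ Complex.I_ne_zero
  linear_combination this

omit hq in
-- The simple pole of the zeta function at x = 1, in the angular variable.
lemma tendsto_mul_coth :
    Tendsto (fun h : ℝ => h * ((1 + circ h) / (2 * (1 - circ h)))) (𝓝[≠] 0) (𝓝 Complex.I) := by
  have h1 := (hasDerivAt_circ 0).tendsto_slope
  have h2 : Tendsto (fun h => -((1 + circ h) / 2)) (𝓝[≠] (0 : ℝ)) (𝓝 (-((1 + circ 0) / 2))) :=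
    ((((hasDerivAt_circ 0).continuousAt.const_add 1).div_const 2).neg).tendsto.mono_left
      nhdsWithin_le_nhds
  have h3 := h2.mul (h1.inv₀ (mul_ne_zero Complex.I_ne_zero (circ_ne_zero 0)))
  have e : -((1 + circ 0) / 2) * (Complex.I * circ 0)⁻¹ = Complex.I := by
    rw [circ_zero]; simp
  rw [e] at h3
  refine h3.congr' ?_
  filter_upwards [self_mem_nhdsWithin] with h hh
  have hh' : (h : ℂ) ≠ 0 := by exact_mod_cast hh
  simp only [slope_def_module, sub_zero, circ_zero, Complex.real_smul, mul_inv, Complex.ofReal_inv,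
    inv_inv]
  rw [show circ h - 1 = -(1 - circ h) by ring, inv_neg, div_eq_mul_inv _ (2 * _), mul_inv]
  ring

/-- The quadratic relation between the zeta function and its derivative. -/
lemma zetaFn_sq {s : ℝ} (hs : circ s ≠ 1) :
    zetaFn q (circ s) ^ 2
      = 1 / 4 + wpFn q (circ s) - 2 * heatFn q (circ s) - 2 * ∑' m, lamSq q m := by
  -- Confluent limit of `fay_circ` at angles s, h, -(s + h) as h → 0: the pole of ζ(h) multiplies
  -- ζ(s) - ζ(s + h) and yields ℘(s), while the heat term at x = 1 yields the constant.
  have hZ := hasDerivAt_zetaFn hq hs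
  have c0 : Tendsto (fun h : ℝ => s + h) (𝓝[≠] 0) (𝓝 s) := by
    have : ContinuousAt (fun h : ℝ => s + h) 0 := by fun_prop
    simpa using this.tendsto.mono_left nhdsWithin_le_nhds
  have hodd : Tendsto (fun h : ℝ => h * oddSeries (lam q) (circ h)) (𝓝[≠] 0) (𝓝 0) := by
    have h1 := (hasDerivAt_oddSeries (w := lam q)
      (by simpa using summable_pow_mul_lam hq 1) 0).continuousAt
    have h2 : ContinuousAt (fun h : ℝ => (h : ℂ) * oddSeries (lam q) (circ h)) 0 :=
      Complex.continuous_ofReal.continuousAt.mul h1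
    simpa using h2.tendsto.mono_left nhdsWithin_le_nhds
  have hzh : Tendsto (fun h : ℝ => h * zetaFn q (circ h)) (𝓝[≠] 0) (𝓝 Complex.I) := by
    have := tendsto_mul_coth.add hodd
    rw [add_zero] at this
    exact this.congr fun h => by rw [zetaFn]; ring
  have hsl : Tendsto (fun h : ℝ => h⁻¹ • (zetaFn q (circ (s + h)) - zetaFn q (circ s)))
      (𝓝[≠] 0) (𝓝 (Complex.I * wpFn q (circ s))) := hZ.tendsto_slope_zero
  have hl := (((hZ.continuousAt.tendsto.comp c0).const_mul (zetaFn q (circ s))).neg).sub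
    (hzh.mul hsl)
  have hr := (((hasDerivAt_heatFn hq s).continuousAt.tendsto.comp c0).const_add
    (-1 / 4 + heatFn q (circ s))).add
    ((hasDerivAt_heatFn hq 0).continuousAt.tendsto.mono_left (nhdsWithin_le_nhds (s := {0}ᶜ)))
  have hne : ∀ᶠ h : ℝ in 𝓝[≠] 0, circ h ≠ 1 := by
    have := (hasDerivAt_circ 0).eventually_ne (c := 1) (by simp [circ_zero])
    simpa using this
  have heq := tendsto_nhds_unique (hl.congr' (by
    filter_upwards [hne, c0.eventually (eventually_circ_ne_one hs), self_mem_nhdsWithin]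
      with h h1 h2 h3
    have h4 : circ (-(s + h)) ≠ 1 := by rwa [circ_neg, ne_eq, inv_eq_one]
    have f := fay_circ hq hs h1 h4
    rw [circ_neg, zetaFn_inv q (circ_ne_zero _) h2, heatFn, heatFn, heatFn, evenSeries_inv] at f
    have hh' : (h : ℂ) ≠ 0 := by exact_mod_cast h3
    have e : (h : ℂ) * zetaFn q (circ h) * h⁻¹ • (zetaFn q (circ (s + h)) - zetaFn q (circ s))
        = zetaFn q (circ h) * (zetaFn q (circ (s + h)) - zetaFn q (circ s)) := by
      rw [Complex.real_smul]; push_cast; field_simp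
    simp only [Function.comp_apply]
    rw [e]
    simp only [heatFn]
    linear_combination f)) hr
  have h0 : heatFn q (circ 0) = 2 * ∑' m, lamSq q m := by
    rw [heatFn, evenSeries, circ_zero, ← tsum_mul_left]
    exact tsum_congr fun m => by simp; ring
  rw [h0] at heq
  linear_combination -heq - wpFn q (circ s) * Complex.I_sq

lemma wpFn'_eq {s : ℝ} (hs : circ s ≠ 1) :
    wpFn' q (circ s) = 2 * zetaFn q (circ s) * wpFn q (circ s) + 2 * zetaFnD q (circ s) := by
  have dx := hasDerivAt_zetaFn hq hs
  have l := dx.mul dx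
  have r := (((hasDerivAt_wpFn hq hs).const_add (1 / 4)).sub
    ((hasDerivAt_heatFn hq s).const_mul 2)).sub_const (2 * ∑' m, lamSq q m)
  have := l.unique (r.congr_of_eventuallyEq (by
    filter_upwards [eventually_circ_ne_one hs] with u h1
    simpa [sq] using zetaFn_sq hq h1))
  apply mul_left_cancel₀ Complex.I_ne_zero
  linear_combination -this

end

/-! ### Derivatives with respect to the nome. -/

/-- The derivative in `q` of the Lambert coefficient `lam q m`. -/
def lamDeriv (q : ℂ) (m : ℕ) : ℂ := m * q ^ (m - 1) / (1 - q ^ m) ^ 2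

lemma mul_lamDeriv (q : ℂ) (m : ℕ) : q * lamDeriv q m = m * lamSq q m := by
  rcases m with _ | m
  · simp [lamDeriv]
  · rw [lamDeriv, lamSq, Nat.add_sub_cancel, pow_succ]; ring

lemma hasDerivAt_lam {q : ℂ} (hq : ‖q‖ < 1) (m : ℕ) :
    HasDerivAt (fun q => lam q m) (lamDeriv q m) q := by
  rcases eq_or_ne m 0 with rfl | hm
  · simpa [lamDeriv] using hasDerivAt_const q (0 : ℂ)
  · have h1 := one_sub_pow_ne_zero hq hm
    refine ((hasDerivAt_pow m q).div ((hasDerivAt_pow m q).const_sub 1) h1).congr_deriv ?_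
    rw [lamDeriv]
    ring

lemma norm_lamDeriv_le {q : ℂ} {r : ℝ} (hqr : ‖q‖ ≤ r) (hr0 : 0 < r) (hr : r < 1) (m : ℕ) :
    ‖lamDeriv q m‖ ≤ 1 / (r * (1 - r) ^ 2) * (m * r ^ m) := by
  have h0 : 0 < 1 - r := by linarith
  rcases m with _ | m
  · simp [lamDeriv]
  · have h1 := one_sub_norm_le (hqr.trans_lt hr) m.succ_ne_zero
    have h2 : 1 - r ≤ ‖1 - q ^ (m + 1)‖ := by
      refine le_trans (by linarith) h1
    rw [lamDeriv, norm_div, norm_mul, norm_pow, norm_pow, Complex.norm_natCast, Nat.add_sub_cancel]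
    calc ((m + 1 : ℕ) : ℝ) * ‖q‖ ^ m / ‖1 - q ^ (m + 1)‖ ^ 2
        ≤ ((m + 1 : ℕ) : ℝ) * r ^ m / (1 - r) ^ 2 := by gcongr
      _ = _ := by field_simp; ring

lemma hasDerivAt_lambert {c : ℕ → ℂ} {k : ℕ} (hc : ∀ m, ‖c m‖ ≤ 2 * (m : ℝ) ^ k) {q : ℂ}
    (hq : ‖q‖ < 1) :
    HasDerivAt (fun q => ∑' m, c m * lam q m) (∑' m, c m * lamDeriv q m) q := by
  obtain ⟨r, hqr, hr⟩ := exists_between hq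
  have hr0 : 0 < r := (norm_nonneg q).trans_lt hqr
  have hrn : ‖r‖ < 1 := by rwa [Real.norm_of_nonneg hr0.le]
  have hu : Summable fun m : ℕ => 2 * (1 / (r * (1 - r) ^ 2)) * ((m : ℝ) ^ (k + 1) * r ^ m) :=
    (summable_pow_mul_geometric_of_norm_lt_one (R := ℝ) (k + 1) hrn).mul_left
      (2 * (1 / (r * (1 - r) ^ 2)))
  have hd : ∀ (m : ℕ) (y : ℂ), y ∈ Metric.ball (0 : ℂ) r →
      HasDerivAt (fun q => c m * lam q m) (c m * lamDeriv y m) y := fun m y hy => by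
    rw [mem_ball_zero_iff] at hy
    exact (hasDerivAt_lam (hy.trans hr) m).const_mul _
  have hb : ∀ (m : ℕ) (y : ℂ), y ∈ Metric.ball (0 : ℂ) r → ‖c m * lamDeriv y m‖
      ≤ 2 * (1 / (r * (1 - r) ^ 2)) * ((m : ℝ) ^ (k + 1) * r ^ m) := fun m y hy => by
    rw [mem_ball_zero_iff] at hy
    rw [norm_mul]
    refine (mul_le_mul (hc m) (norm_lamDeriv_le hy.le hr0 hr m) (norm_nonneg _)
      (by positivity)).trans (le_of_eq ?_)
    ring
  have hs : Summable fun m => c m * lam q m := by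
    refine Summable.of_norm_bounded ((summable_pow_mul_lam hq k).mul_left 2) fun m => ?_
    rw [norm_mul, ← mul_assoc]
    exact mul_le_mul_of_nonneg_right (hc m) (norm_nonneg _)
  have hqm : q ∈ Metric.ball (0 : ℂ) r := by rwa [mem_ball_zero_iff]
  have hp : IsPreconnected (Metric.ball (0 : ℂ) r) := (convex_ball (0 : ℂ) r).isPreconnected
  exact hasDerivAt_tsum_of_isPreconnected hu Metric.isOpen_ball hp hd hb hqm hs hqm

lemma mul_tsum_lamDeriv (c : ℕ → ℂ) (q : ℂ) :
    q * ∑' m, c m * lamDeriv q m = ∑' m, m * lamSq q m * c m := by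
  rw [← tsum_mul_left]
  exact tsum_congr fun m => by rw [← mul_lamDeriv]; ring

lemma tsum_lamDeriv_zero (c : ℕ → ℂ) : ∑' m, c m * lamDeriv 0 m = c 1 := by
  rw [tsum_eq_single 1]
  · simp [lamDeriv]
  · intro m hm
    rcases m with _ | _ | m
    · simp [lamDeriv]
    · exact absurd rfl hm
    · simp [lamDeriv]

/-- The equation for q d says nothing about d at q = 0, so this value is recorded separately; it is
the first Fourier coefficient, used in `W_sub_V_ne_zero`. -/
lemma hasDerivAt_zetaFn_nome {x : ℂ} (hx : ‖x‖ = 1) {q : ℂ} (hq : ‖q‖ < 1) :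
    ∃ d, HasDerivAt (fun q => zetaFn q x) d q ∧ q * d = zetaFnD q x ∧ (q = 0 → d = x - x⁻¹) := by
  have h := hasDerivAt_lambert (c := fun m => x ^ m - x⁻¹ ^ m) (k := 0) (fun m => by
    refine (norm_sub_le _ _).trans ?_
    simp [hx]; norm_num) hq
  refine ⟨_, (h.const_add ((1 + x) / (2 * (1 - x)))).congr_of_eventuallyEq
    (.of_forall fun q => ?_), mul_tsum_lamDeriv _ q, ?_⟩
  · simp only [zetaFn, oddSeries, mul_comm]
  · rintro rfl
    simpa using tsum_lamDeriv_zero fun m => x ^ m - x⁻¹ ^ m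

lemma hasDerivAt_wpFn_nome {x : ℂ} (hx : ‖x‖ = 1) {q : ℂ} (hq : ‖q‖ < 1) :
    ∃ d, HasDerivAt (fun q => wpFn q x) d q ∧ q * d = wpFnD q x := by
  have h := hasDerivAt_lambert (c := fun m => m * (x ^ m + x⁻¹ ^ m)) (k := 1) (fun m => by
    rw [norm_mul, Complex.norm_natCast, mul_comm, pow_one]
    gcongr
    refine (norm_add_le _ _).trans ?_
    simp [hx]; norm_num) hq
  refine ⟨_, (h.const_add (x / (1 - x) ^ 2)).congr_of_eventuallyEq
    (.of_forall fun q => ?_), ?_⟩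
  · simp only [wpFn, evenSeries]
    congr 1
    exact tsum_congr fun m => by ring
  · rw [mul_tsum_lamDeriv, wpFnD, evenSeries]
    exact tsum_congr fun m => by ring

/-! ### Specialisation to fifth roots of unity. -/

/-- The primitive fifth root of unity `exp (2 π i / 5)`. -/
def zeta5 : ℂ := circ (2 * Real.pi / 5)

lemma norm_zeta5 : ‖zeta5‖ = 1 := norm_circ _

lemma norm_zeta5_sq : ‖zeta5 ^ 2‖ = 1 := by rw [norm_pow, norm_zeta5, one_pow]

lemma zeta5_ne_zero : zeta5 ≠ 0 := circ_ne_zero _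

lemma circ_four : circ (4 * Real.pi / 5) = zeta5 ^ 2 := by
  rw [zeta5, sq, ← circ_add]; congr 1; ring

lemma zeta5_pow_five : zeta5 ^ 5 = 1 := by
  rw [zeta5, circ_pow]
  convert Complex.exp_two_pi_mul_I using 2
  push_cast; ring

lemma sqrt_five_sq : ((√5 : ℝ) : ℂ) ^ 2 = 5 := by
  rw [← Complex.ofReal_pow, Real.sq_sqrt (by norm_num)]; norm_num

lemma zeta5_add_inv : zeta5 + zeta5⁻¹ = ((√5 : ℝ) - 1) / 2 := by
  have h1 : zeta5 + zeta5⁻¹ = ((2 * Real.cos (2 * Real.pi / 5) : ℝ) : ℂ) := by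
    rw [zeta5, ← circ_neg, circ, circ]
    push_cast
    rw [Complex.two_cos]
    congr 2 <;> ring
  rw [h1, show 2 * Real.pi / 5 = 2 * (Real.pi / 5) by ring, Real.cos_two_mul,
    Real.cos_pi_div_five]
  push_cast
  linear_combination (1 / 4 : ℂ) * sqrt_five_sq

lemma zeta5_sq : zeta5 ^ 2 = ((√5 : ℝ) - 1) / 2 * zeta5 - 1 := by
  have h := zeta5_add_inv
  have h0 := zeta5_ne_zero
  field_simp at h
  linear_combination (1 / 2 : ℂ) * h

lemma zeta5_ne_one : zeta5 ≠ 1 := by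
  intro h
  have h1 := zeta5_sq
  rw [h] at h1
  have h2 : ((√5 : ℝ) : ℂ) = 5 := by linear_combination -2 * h1
  have h3 := sqrt_five_sq
  rw [h2] at h3
  norm_num at h3

lemma zeta5_sq_ne_one : zeta5 ^ 2 ≠ 1 := by
  intro h
  apply zeta5_ne_one
  calc zeta5 = zeta5 ^ 5 := by rw [show zeta5 ^ 5 = (zeta5 ^ 2) ^ 2 * zeta5 by ring, h]; ring
    _ = 1 := zeta5_pow_five

section

variable {q : ℂ} (hq : ‖q‖ < 1)
include hq

/-- The Fay identity at (ε, ε, ε⁻²), with ε = `zeta5`; parity brings ε⁻² back to ε². -/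
lemma heatFn_relation_one :
    zetaFn q zeta5 ^ 2 - 2 * zetaFn q zeta5 * zetaFn q (zeta5 ^ 2)
      = -1 / 4 + 2 * heatFn q zeta5 + heatFn q (zeta5 ^ 2) := by
  have e : circ (-(2 * Real.pi / 5 + 2 * Real.pi / 5)) = (zeta5 ^ 2)⁻¹ := by
    rw [circ_neg, circ_add, sq]; rfl
  have h := fay_circ hq zeta5_ne_one zeta5_ne_one (by rw [e, ne_eq, inv_eq_one]; exact
    zeta5_sq_ne_one)
  rw [e, zetaFn_inv q (pow_ne_zero 2 zeta5_ne_zero) zeta5_sq_ne_one, heatFn, heatFn,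
    evenSeries_inv] at h
  simp only [heatFn, zeta5] at h ⊢
  linear_combination h

/-- The Fay identity at (ε², ε², ε): here ε⁻⁴ = ε closes the system. -/
lemma heatFn_relation_two :
    zetaFn q (zeta5 ^ 2) ^ 2 + 2 * zetaFn q zeta5 * zetaFn q (zeta5 ^ 2)
      = -1 / 4 + 2 * heatFn q (zeta5 ^ 2) + heatFn q zeta5 := by
  have e : circ (-(4 * Real.pi / 5 + 4 * Real.pi / 5)) = zeta5 := by
    rw [circ_neg, circ_add, circ_four]
    exact inv_eq_of_mul_eq_one_left (by rw [← zeta5_pow_five]; ring)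
  have h2 : circ (4 * Real.pi / 5) ≠ 1 := by rw [circ_four]; exact zeta5_sq_ne_one
  have h := fay_circ hq h2 h2 (by rw [e]; exact zeta5_ne_one)
  rw [e, circ_four] at h
  linear_combination h

lemma zetaFnD_relation_one :
    wpFn q zeta5 * (zetaFn q zeta5 - zetaFn q (zeta5 ^ 2))
      - wpFn q (zeta5 ^ 2) * (2 * zetaFn q zeta5)
      = zetaFnD q zeta5 + zetaFnD q (zeta5 ^ 2) := by
  have e : circ (-(2 * Real.pi / 5 + 2 * Real.pi / 5)) = (zeta5 ^ 2)⁻¹ := by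
    rw [circ_neg, circ_add, sq]; rfl
  have h := fay_deriv hq zeta5_ne_one zeta5_ne_one (by rw [e, ne_eq, inv_eq_one]; exact
    zeta5_sq_ne_one)
  rw [e, zetaFn_inv q (pow_ne_zero 2 zeta5_ne_zero) zeta5_sq_ne_one,
    wpFn_inv q (pow_ne_zero 2 zeta5_ne_zero) zeta5_sq_ne_one, zetaFnD, zetaFnD,
    oddSeries_inv] at h
  simp only [zetaFnD, zeta5] at h ⊢
  linear_combination h

lemma zetaFnD_relation_two :
    wpFn q (zeta5 ^ 2) * (zetaFn q (zeta5 ^ 2) + zetaFn q zeta5)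
      - wpFn q zeta5 * (2 * zetaFn q (zeta5 ^ 2))
      = zetaFnD q (zeta5 ^ 2) - zetaFnD q zeta5 := by
  have e : circ (-(4 * Real.pi / 5 + 4 * Real.pi / 5)) = zeta5 := by
    rw [circ_neg, circ_add, circ_four]
    exact inv_eq_of_mul_eq_one_left (by rw [← zeta5_pow_five]; ring)
  have h2 : circ (4 * Real.pi / 5) ≠ 1 := by rw [circ_four]; exact zeta5_sq_ne_one
  have h := fay_deriv hq h2 h2 (by rw [e]; exact zeta5_ne_one)
  rw [e, circ_four] at h
  linear_combination h

/-- The second derivative of Fay at x = z = ε, y = ε⁻², where its two halves coincide. -/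
lemma wpFnD_relation :
    wpFnD q zeta5 = wpFn' q zeta5 * (zetaFn q zeta5 - zetaFn q (zeta5 ^ 2)) - wpFn q zeta5 ^ 2 := by
  have e : circ (-(4 * Real.pi / 5)) = (zeta5 ^ 2)⁻¹ := by rw [circ_neg, circ_four]
  have e2 : -(2 * Real.pi / 5 + -(4 * Real.pi / 5)) = 2 * Real.pi / 5 := by ring
  have h := fay_deriv_deriv hq (s := 2 * Real.pi / 5) (t := -(4 * Real.pi / 5)) zeta5_ne_one
    (by rw [e, ne_eq, inv_eq_one]; exact zeta5_sq_ne_one) (by rw [e2]; exact zeta5_ne_one)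
  rw [e2, e, zetaFn_inv q (pow_ne_zero 2 zeta5_ne_zero) zeta5_sq_ne_one] at h
  simp only [zeta5] at h ⊢
  linear_combination (-1 / 2 : ℂ) * h

lemma wpFn'_zeta5 : wpFn' q zeta5 = 2 * zetaFn q zeta5 * wpFn q zeta5 + 2 * zetaFnD q zeta5 :=
  wpFn'_eq hq zeta5_ne_one

lemma zetaFn_zeta5_sq :
    zetaFn q zeta5 ^ 2
      = 1 / 4 + wpFn q zeta5 - 2 * heatFn q zeta5 - 2 * ∑' m, lamSq q m :=
  zetaFn_sq hq zeta5_ne_one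

lemma zetaFn_zeta5_sq_sq :
    zetaFn q (zeta5 ^ 2) ^ 2
      = 1 / 4 + wpFn q (zeta5 ^ 2) - 2 * heatFn q (zeta5 ^ 2) - 2 * ∑' m, lamSq q m := by
  rw [← circ_four]
  exact zetaFn_sq hq (by rw [circ_four]; exact zeta5_sq_ne_one)

/-- Subtracting the two formulas for ζ² removes the constant Lambert series, and the heat terms are
eliminated by the Fay relations. So ζ(ε), ζ(ε²), ℘(ε) suffice as generators. -/
lemma wpFn_zeta5_sub :
    wpFn q (zeta5 ^ 2) = wpFn q zeta5
      - (3 * zetaFn q zeta5 + zetaFn q (zeta5 ^ 2)) * (zetaFn q zeta5 - 3 * zetaFn q (zeta5 ^ 2)) := by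
  linear_combination zetaFn_zeta5_sq hq - zetaFn_zeta5_sq_sq hq + 2 * heatFn_relation_one hq
    - 2 * heatFn_relation_two hq

end

/-! ### Eisenstein series of weight one and their differential equations. -/

/-- The logarithmic derivative `q d/dq log V` as a combination of Lambert series. -/
def logV (q : ℂ) : ℂ := -2 * ∑' m, lamSq q m - 2 * heatFn q zeta5 + 3 * heatFn q (zeta5 ^ 2)

/-- The logarithmic derivative `q d/dq log W` as a combination of Lambert series. -/
def logW (q : ℂ) : ℂ := -2 * ∑' m, lamSq q m + 3 * heatFn q zeta5 - 2 * heatFn q (zeta5 ^ 2)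

/-- The Eisenstein series proportional to `V`. -/
def eisV (q : ℂ) : ℂ := zetaFn q zeta5 - 3 * zetaFn q (zeta5 ^ 2)

/-- The Eisenstein series proportional to `W`. -/
def eisW (q : ℂ) : ℂ := 3 * zetaFn q zeta5 + zetaFn q (zeta5 ^ 2)

section

variable {q : ℂ} (hq : ‖q‖ < 1)
include hq

lemma logV_eq : logV q = 2 * zetaFn q (zeta5 ^ 2) ^ 2
    + 6 * zetaFn q zeta5 * zetaFn q (zeta5 ^ 2) - wpFn q zeta5 := by
  rw [logV]
  linear_combination -zetaFn_zeta5_sq hq - 2 * heatFn_relation_two hq + heatFn_relation_one hq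

lemma logW_sub_logV : logW q - logV q = 5 * (zetaFn q zeta5 ^ 2
    - 4 * zetaFn q zeta5 * zetaFn q (zeta5 ^ 2) - zetaFn q (zeta5 ^ 2) ^ 2) := by
  rw [logV, logW]
  linear_combination 5 * heatFn_relation_two hq - 5 * heatFn_relation_one hq

/-- The two relations for `zetaFnD` determine the q-derivatives of ζ(ε) and ζ(ε²); in this
combination the result is divisible by `eisV` itself, with quotient `logV`. -/
lemma hasDerivAt_eisV : ∃ d, HasDerivAt eisV d q ∧ q * d = eisV q * logV q ∧
    (q = 0 → d = (zeta5 - zeta5⁻¹) - 3 * (zeta5 ^ 2 - (zeta5 ^ 2)⁻¹)) := by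
  obtain ⟨d1, h1, e1, z1⟩ := hasDerivAt_zetaFn_nome norm_zeta5 hq
  obtain ⟨d2, h2, e2, z2⟩ := hasDerivAt_zetaFn_nome norm_zeta5_sq hq
  refine ⟨_, h1.sub (h2.const_mul 3), ?_, fun h0 => by rw [z1 h0, z2 h0]⟩
  rw [logV_eq hq, eisV]
  have f1 := zetaFnD_relation_one hq
  have f2 := zetaFnD_relation_two hq
  rw [← e1, ← e2, wpFn_zeta5_sub hq] at f1 f2
  linear_combination f1 + 2 * f2

lemma hasDerivAt_eisW : ∃ d, HasDerivAt eisW d q ∧ q * d = eisW q * logW q ∧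
    (q = 0 → d = 3 * (zeta5 - zeta5⁻¹) + (zeta5 ^ 2 - (zeta5 ^ 2)⁻¹)) := by
  obtain ⟨d1, h1, e1, z1⟩ := hasDerivAt_zetaFn_nome norm_zeta5 hq
  obtain ⟨d2, h2, e2, z2⟩ := hasDerivAt_zetaFn_nome norm_zeta5_sq hq
  refine ⟨_, (h1.const_mul 3).add h2, ?_, fun h0 => by rw [z1 h0, z2 h0]⟩
  rw [← sub_add_cancel (logW q) (logV q), logW_sub_logV hq, logV_eq hq, eisW]
  have f1 := zetaFnD_relation_one hq
  have f2 := zetaFnD_relation_two hq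
  rw [← e1, ← e2, wpFn_zeta5_sub hq] at f1 f2
  linear_combination -2 * f1 + f2

lemma hasDerivAt_logV : ∃ d, HasDerivAt logV d q ∧ q * d = logV q ^ 2
    + eisW q * (eisW q - 3 * eisV q) * (logW q - logV q) / 5 := by
  obtain ⟨d1, h1, e1, z1⟩ := hasDerivAt_zetaFn_nome norm_zeta5 hq
  obtain ⟨d2, h2, e2, z2⟩ := hasDerivAt_zetaFn_nome norm_zeta5_sq hq
  obtain ⟨d3, h3, e3⟩ := hasDerivAt_wpFn_nome norm_zeta5 hq
  have h := (((h2.mul h2).const_mul 2).add ((h1.mul h2).const_mul 6)).sub h3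
  refine ⟨_, h.congr_of_eventuallyEq ?_, ?_⟩
  · have : ∀ᶠ t : ℂ in 𝓝 q, ‖t‖ < 1 := continuous_norm.continuousAt.eventually_lt_const hq
    filter_upwards [this] with t ht
    rw [logV_eq ht]; simp; ring
  rw [logW_sub_logV hq, logV_eq hq, eisV, eisW]
  have f1 := zetaFnD_relation_one hq
  have f2 := zetaFnD_relation_two hq
  have f3 := wpFnD_relation hq
  rw [wpFn'_zeta5 hq] at f3
  rw [← e1, ← e2, wpFn_zeta5_sub hq] at f1 f2
  rw [← e1, ← e3] at f3
  generalize zetaFn q zeta5 = a at *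
  generalize zetaFn q (zeta5 ^ 2) = b at *
  generalize wpFn q zeta5 = A at *
  -- The linear relations `f1`, `f2` solved for the two derivatives; what remains is a polynomial
  -- identity in a, b, A.
  have g1 : q * d1 = -a * A + (3 * a + b) ^ 2 * (a - 3 * b) / 2 := by
    linear_combination (f2 - f1) / 2
  have g2 : q * d2 = -b * A + (3 * a + b) * (a - 3 * b) * (a - b) / 2 := by
    linear_combination -(f1 + f2) / 2
  linear_combination -f3 + (4 * b + 6 * a) * g2 + (6 * b - 2 * (a - b)) * g1

end

/-! ### The infinite products and their logarithmic derivatives. -/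

lemma one_sub_mul_ne_zero {t y : ℂ} (ht : ‖t‖ = 1) (hy : ‖y‖ < 1) : 1 - t * y ≠ 0 := by
  intro h
  have h1 : ‖t * y‖ = 1 := by rw [← sub_eq_zero.mp h]; simp
  rw [norm_mul, ht, one_mul] at h1
  exact absurd h1 hy.ne

/-- Both sides are the double series of n tᵐ q^(mn) over m, n ≥ 1: rows are geometric, columns use ∑
n yⁿ = y/(1 - y)². -/
lemma hasSum_lambert_swap {t q : ℂ} (ht : ‖t‖ = 1) (hq : ‖q‖ < 1) :
    HasSum (fun n : ℕ => ((n : ℂ) + 1) * (t * q ^ (n + 1) / (1 - t * q ^ (n + 1))))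
      (∑' m, lamSq q m * t ^ m) := by
  set F : ℕ × ℕ → ℂ := fun p => ((p.1 : ℂ) + 1) * (t * q ^ (p.1 + 1)) ^ (p.2 + 1) with hF
  have hr0 := norm_nonneg q
  have hs : Summable F := by
    have h1 : Summable fun n : ℕ => ((n : ℝ) + 1) * ‖q‖ ^ n := by
      refine ((summable_pow_mul_geometric_of_norm_lt_one (R := ℝ) (r := ‖q‖) 1 (by simpa)).add
        (summable_geometric_of_lt_one hr0 hq)).congr fun n => ?_
      ring
    have h2 : Summable fun p : ℕ × ℕ => (((p.1 : ℝ) + 1) * ‖q‖ ^ p.1) * ‖q‖ ^ p.2 :=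
      h1.mul_of_nonneg (summable_geometric_of_lt_one hr0 hq) (fun _ => by positivity)
        (fun _ => by positivity)
    refine Summable.of_norm_bounded h2 fun p => ?_
    have e : ‖((p.1 : ℂ) + 1)‖ = (p.1 : ℝ) + 1 := by
      exact_mod_cast Complex.norm_natCast (p.1 + 1)
    rw [hF, norm_mul, norm_pow, norm_mul, ht, one_mul, norm_pow, e, ← pow_mul, mul_assoc,
      ← pow_add]
    exact mul_le_mul_of_nonneg_left (pow_le_pow_of_le_one hr0 hq.le (by nlinarith)) (by positivity)
  have hpow : ∀ n : ℕ, ‖t * q ^ (n + 1)‖ < 1 := fun n => by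
    rw [norm_mul, ht, one_mul, norm_pow]; exact pow_lt_one₀ hr0 hq n.succ_ne_zero
  have row : ∀ n : ℕ, HasSum (fun m => F (n, m))
      (((n : ℂ) + 1) * (t * q ^ (n + 1) / (1 - t * q ^ (n + 1)))) := fun n => by
    have := ((hasSum_geometric_of_norm_lt_one (hpow n)).mul_left (t * q ^ (n + 1))).mul_left
      ((n : ℂ) + 1)
    rw [← div_eq_mul_inv] at this
    simpa only [hF, pow_succ'] using this
  have col : ∀ m : ℕ, HasSum (fun n => F (n, m)) (lamSq q (m + 1) * t ^ (m + 1)) := fun m => by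
    have hm : ‖q ^ (m + 1)‖ < 1 := by rw [norm_pow]; exact pow_lt_one₀ hr0 hq m.succ_ne_zero
    have h := hasSum_coe_mul_geometric_of_norm_lt_one hm
    have h1 := (hasSum_nat_add_iff' 1).mpr h
    have h2 := h1.mul_right (t ^ (m + 1))
    simp only [Finset.range_one, Finset.sum_singleton, Nat.cast_zero, zero_mul, sub_zero] at h2
    refine h2.congr_fun fun n => ?_
    simp only [hF, mul_pow, ← pow_mul]
    push_cast
    ring
  have hcol : HasSum (fun m => lamSq q (m + 1) * t ^ (m + 1)) (∑' p, F p) := by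
    have := ((Equiv.prodComm ℕ ℕ).hasSum_iff.mpr hs.hasSum).prod_fiberwise
      (g := fun m => lamSq q (m + 1) * t ^ (m + 1)) (fun m => col m)
    exact this
  have h0 : HasSum (fun m => lamSq q m * t ^ m) (∑' p, F p) := by
    have := (hasSum_nat_add_iff (f := fun m => lamSq q m * t ^ m) 1).mp hcol
    simpa using this
  rw [h0.tsum_eq]
  exact hs.hasSum.prod_fiberwise row

/-- The factor of the product defining `V` and `W`, written with the fifth roots of unity. -/
def rootFactor (x x' y : ℂ) : ℂ :=
  ((1 - y) * ((1 - x * y) * (1 - x⁻¹ * y))) ^ 2 / ((1 - x' * y) * (1 - x'⁻¹ * y)) ^ 3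

/-- The product of `rootFactor` over the powers of `q`. -/
def rootProduct (x x' q : ℂ) : ℂ := ∏' n : ℕ, rootFactor x x' (q ^ (n + 1))

section

variable {x x' : ℂ} (hx : ‖x‖ = 1) (hx' : ‖x'‖ = 1)
include hx hx'

lemma rootFactor_ne_zero {y : ℂ} (hy : ‖y‖ < 1) : rootFactor x x' y ≠ 0 := by
  have h0 := one_sub_mul_ne_zero norm_one hy
  rw [one_mul] at h0
  have hi : ‖x⁻¹‖ = 1 := by simp [hx]
  have hi' : ‖x'⁻¹‖ = 1 := by simp [hx']
  exact div_ne_zero (pow_ne_zero _ (mul_ne_zero h0 (mul_ne_zero (one_sub_mul_ne_zero hx hy)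
    (one_sub_mul_ne_zero hi hy)))) (pow_ne_zero _ (mul_ne_zero (one_sub_mul_ne_zero hx' hy)
    (one_sub_mul_ne_zero hi' hy)))

lemma logDeriv_rootFactor {y : ℂ} (hy : ‖y‖ < 1) :
    DifferentiableAt ℂ (rootFactor x x') y ∧ y * logDeriv (rootFactor x x') y
      = -2 * (y / (1 - y)) - 2 * (x * y / (1 - x * y)) - 2 * (x⁻¹ * y / (1 - x⁻¹ * y))
        + 3 * (x' * y / (1 - x' * y)) + 3 * (x'⁻¹ * y / (1 - x'⁻¹ * y)) := by
  have h0 := one_sub_mul_ne_zero norm_one hy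
  have h1 := one_sub_mul_ne_zero hx hy
  have h2 := one_sub_mul_ne_zero (t := x⁻¹) (by simp [hx]) hy
  have h3 := one_sub_mul_ne_zero hx' hy
  have h4 := one_sub_mul_ne_zero (t := x'⁻¹) (by simp [hx']) hy
  have lin : ∀ t : ℂ, HasDerivAt (fun y => 1 - t * y) (-t) y := fun t => by
    simpa using ((hasDerivAt_id y).const_mul t).const_sub 1
  have l0 := lin 1
  rw [one_mul] at h0
  simp only [one_mul] at l0
  have d1 := (l0.fun_mul ((lin x).fun_mul (lin x⁻¹))).fun_pow 2
  have d2 := ((lin x').fun_mul (lin x'⁻¹)).fun_pow 3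
  have d := d1.fun_div d2 (pow_ne_zero _ (mul_ne_zero h3 h4))
  have e : HasDerivAt (rootFactor x x') _ y := d
  refine ⟨e.differentiableAt, ?_⟩
  rw [logDeriv_apply, e.deriv, rootFactor]
  generalize x⁻¹ = w at *
  generalize x'⁻¹ = w' at *
  clear d d1 d2 e l0 lin
  generalize 1 - y = a0 at *
  generalize 1 - x * y = a1 at *
  generalize 1 - w * y = a2 at *
  generalize 1 - x' * y = a3 at *
  generalize 1 - w' * y = a4 at *
  simp only [Nat.cast_ofNat, Nat.add_one_sub_one, pow_one]
  field_simp
  ring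

lemma differentiableOn_rootFactor {r : ℝ} (hr : r ≤ 1) :
    DifferentiableOn ℂ (rootFactor x x') (Metric.ball 0 r) := fun y hy => by
  rw [mem_ball_zero_iff] at hy
  exact (logDeriv_rootFactor hx hx' (hy.trans_le hr)).1.differentiableWithinAt

/-- The factor is 1 at y = 0 and has bounded derivative on the smaller disc. This is the majorant
for locally uniform convergence of the product. -/
lemma exists_norm_rootFactor_sub_one_le {r : ℝ} (hr : r < 1) :
    ∃ C, ∀ y : ℂ, ‖y‖ ≤ r → ‖rootFactor x x' y - 1‖ ≤ C * ‖y‖ := by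
  have hd := differentiableOn_rootFactor hx hx' le_rfl
  have hsub : Metric.closedBall (0 : ℂ) r ⊆ Metric.ball 0 1 := Metric.closedBall_subset_ball hr
  obtain ⟨C, hC⟩ := (isCompact_closedBall (0 : ℂ) r).exists_bound_of_continuousOn
    (((hd.deriv Metric.isOpen_ball).continuousOn).mono hsub)
  refine ⟨C, fun y hy => ?_⟩
  have hr0 := (norm_nonneg y).trans hy
  have := (convex_closedBall (0 : ℂ) r).norm_image_sub_le_of_norm_deriv_le
    (fun z hz => hd.differentiableAt (Metric.isOpen_ball.mem_nhds (hsub hz))) hC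
    (x := 0) (y := y) (by simpa using hr0) (by simpa using hy)
  simpa [rootFactor] using this

lemma differentiableOn_rootFactor_pow {r : ℝ} (hr : r ≤ 1) (n : ℕ) :
    DifferentiableOn ℂ (fun q => rootFactor x x' (q ^ (n + 1))) (Metric.ball 0 r) := by
  refine (differentiableOn_rootFactor hx hx' le_rfl).comp
    ((differentiable_pow (n + 1)).differentiableOn) fun q hq => ?_
  rw [mem_ball_zero_iff] at hq ⊢
  rw [norm_pow]
  exact pow_lt_one₀ (norm_nonneg _) (hq.trans_le hr) n.succ_ne_zero

lemma multipliable_rootFactor {r : ℝ} (hr0 : 0 ≤ r) (hr : r < 1) :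
    HasProdLocallyUniformlyOn (fun n q => rootFactor x x' (q ^ (n + 1))) (rootProduct x x')
      (Metric.ball 0 r) ∧
    ∀ q ∈ Metric.ball (0 : ℂ) r, rootProduct x x' q ≠ 0 := by
  obtain ⟨C, hC⟩ := exists_norm_rootFactor_sub_one_le hx hx' hr
  have hC0 : ∀ q : ℂ, ‖q‖ ≤ r → ∀ n, ‖rootFactor x x' (q ^ (n + 1)) - 1‖ ≤ |C| * r ^ (n + 1) :=
    fun q hq n => by
      have h1 : ‖q ^ (n + 1)‖ ≤ r ^ (n + 1) := by
        rw [norm_pow]; exact pow_le_pow_left₀ (norm_nonneg _) hq _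
      refine (hC _ (h1.trans (pow_le_of_le_one hr0 hr.le n.succ_ne_zero))).trans ?_
      exact mul_le_mul (le_abs_self C) h1 (norm_nonneg _) (abs_nonneg C)
  have hu : Summable fun n : ℕ => |C| * r ^ (n + 1) :=
    ((summable_nat_add_iff 1).mpr (summable_geometric_of_lt_one hr0 hr)).mul_left _
  constructor
  · have := hu.hasProdLocallyUniformlyOn_nat_one_add Metric.isOpen_ball
      (f := fun n q => rootFactor x x' (q ^ (n + 1)) - 1) (K := Metric.ball (0 : ℂ) r)
      (.of_forall fun n q hq => hC0 q (mem_ball_zero_iff.mp hq).le n)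
      (fun n => ((differentiableOn_rootFactor_pow hx hx' hr.le n).sub_const 1).continuousOn)
    simp only [add_sub_cancel] at this
    exact this
  · intro q hq
    rw [mem_ball_zero_iff] at hq
    have := tprod_one_add_ne_zero_of_summable
      (f := fun n : ℕ => rootFactor x x' (q ^ (n + 1)) - 1)
      (fun n => by
        rw [add_sub_cancel]
        refine rootFactor_ne_zero hx hx' ?_
        rw [norm_pow]
        exact pow_lt_one₀ (norm_nonneg _) (hq.trans hr) n.succ_ne_zero)
      (Summable.of_nonneg_of_le (fun _ => norm_nonneg _) (hC0 q hq.le) hu)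
    simp only [add_sub_cancel] at this
    exact this

lemma rootProduct_ne_zero {q : ℂ} (hq : ‖q‖ < 1) : rootProduct x x' q ≠ 0 := by
  obtain ⟨r, hqr, hr⟩ := exists_between hq
  exact (multipliable_rootFactor hx hx' ((norm_nonneg q).trans hqr.le) hr).2 q (by simpa using hqr)

lemma differentiableAt_rootProduct {q : ℂ} (hq : ‖q‖ < 1) :
    DifferentiableAt ℂ (rootProduct x x') q := by
  obtain ⟨r, hqr, hr⟩ := exists_between hq
  refine ((multipliable_rootFactor hx hx' ((norm_nonneg q).trans hqr.le) hr).1.differentiableOn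
    (.of_forall fun s => ?_) Metric.isOpen_ball).differentiableAt
    (Metric.isOpen_ball.mem_nhds (by simpa using hqr))
  simpa [Finset.prod_fn] using
    DifferentiableOn.finsetProd (fun n _ => differentiableOn_rootFactor_pow hx hx' hr.le n)

lemma mul_logDeriv_rootProduct {q : ℂ} (hq : ‖q‖ < 1) (h0 : q ≠ 0) :
    q * logDeriv (rootProduct x x') q
      = -2 * ∑' m, lamSq q m - 2 * heatFn q x + 3 * heatFn q x' := by
  obtain ⟨r, hqr, hr⟩ := exists_between hq
  have hqm : q ∈ Metric.ball (0 : ℂ) r := by simpa using hqr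
  obtain ⟨hm, hnz⟩ := multipliable_rootFactor hx hx' ((norm_nonneg q).trans hqr.le) hr
  have hpow : ∀ n : ℕ, ‖q ^ (n + 1)‖ < 1 := fun n => by
    rw [norm_pow]; exact pow_lt_one₀ (norm_nonneg _) hq n.succ_ne_zero
  have hi : ‖x⁻¹‖ = 1 := by simp [hx]
  have hi' : ‖x'⁻¹‖ = 1 := by simp [hx']
  have sum := ((((hasSum_lambert_swap (t := 1) norm_one hq).mul_left (-2)).sub
    ((hasSum_lambert_swap hx hq).mul_left 2)).sub ((hasSum_lambert_swap hi hq).mul_left 2)).add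
    ((hasSum_lambert_swap hx' hq).mul_left 3) |>.add ((hasSum_lambert_swap hi' hq).mul_left 3)
  have term : ∀ n : ℕ, logDeriv (fun q => rootFactor x x' (q ^ (n + 1))) q
      = q⁻¹ * (((n : ℂ) + 1) * (q ^ (n + 1) * logDeriv (rootFactor x x') (q ^ (n + 1)))) := by
    intro n
    have := logDeriv_comp (f := rootFactor x x') (g := fun q : ℂ => q ^ (n + 1)) (x := q)
      (logDeriv_rootFactor hx hx' (hpow n)).1 (by fun_prop)
    simp only [Function.comp_def] at this
    rw [this, (hasDerivAt_pow (n + 1) q).deriv, Nat.add_sub_cancel, pow_succ]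
    push_cast
    field_simp
  have hs : HasSum (fun n : ℕ => logDeriv (fun q => rootFactor x x' (q ^ (n + 1))) q) _ :=
    (sum.mul_left q⁻¹).congr_fun fun n => by
      rw [term, (logDeriv_rootFactor hx hx' (hpow n)).2]
      simp only [one_mul]
      ring
  have key := logDeriv_tprod_eq_tsum Metric.isOpen_ball hqm
    (f := fun n q => rootFactor x x' (q ^ (n + 1)))
    (fun n => rootFactor_ne_zero hx hx' (hpow n))
    (fun n => differentiableOn_rootFactor_pow hx hx' hr.le n) hs.summable
    hm.multipliableLocallyUniformlyOn (hnz q hqm)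
  rw [hs.tsum_eq] at key
  have heat : ∀ {t : ℂ}, ‖t‖ = 1 →
      heatFn q t = ∑' m, lamSq q m * t ^ m + ∑' m, lamSq q m * t⁻¹ ^ m := fun {t} ht => by
    have hb : ∀ {t : ℂ}, ‖t‖ = 1 → Summable fun m => lamSq q m * t ^ m := fun ht =>
      Summable.of_norm_bounded (summable_norm_lamSq hq) fun m => by simp [ht]
    rw [← Summable.tsum_add (hb ht) (hb (by simp [ht])), heatFn, evenSeries]
    exact tsum_congr fun m => by ring
  have hP : logDeriv (rootProduct x x') q = logDeriv (fun q => ∏' n : ℕ,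
    rootFactor x x' (q ^ (n + 1))) q := rfl
  rw [hP, key, heat hx, heat hx']
  simp only [one_pow, mul_one]
  field_simp
  ring

end

lemma rootProduct_zero (x x' : ℂ) : rootProduct x x' 0 = 1 := by
  have : ∀ n : ℕ, rootFactor x x' ((0 : ℂ) ^ (n + 1)) = 1 := fun n => by simp [rootFactor]
  simp only [rootProduct, this, tprod_one]

/-! ### Identification of the Eisenstein series with the products. -/

/-- Two functions with the same logarithmic derivative on the disc are proportional. -/
lemma mul_eq_mul_of_logDeriv_eq {E R l : ℂ → ℂ}
    (hE : ∀ q, ‖q‖ < 1 → ∃ d, HasDerivAt E d q ∧ q * d = E q * l q)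
    (hR : ∀ q, ‖q‖ < 1 → DifferentiableAt ℂ R q) (hR0 : ∀ q, ‖q‖ < 1 → R q ≠ 0)
    (hRl : ∀ q, ‖q‖ < 1 → q ≠ 0 → q * logDeriv R q = l q) {q : ℂ} (hq : ‖q‖ < 1) :
    E q * R 0 = E 0 * R q := by
  have hd : DifferentiableOn ℂ (fun q => E q / R q) (Metric.ball 0 1) := fun z hz => by
    rw [mem_ball_zero_iff] at hz
    obtain ⟨d, h, -⟩ := hE z hz
    exact (h.differentiableAt.div (hR z hz) (hR0 z hz)).differentiableWithinAt
  have hne : ∀ z ∈ Metric.ball (0 : ℂ) 1, z ≠ 0 → deriv (fun q => E q / R q) z = 0 := by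
    intro z hz h0
    rw [mem_ball_zero_iff] at hz
    obtain ⟨d, h, e⟩ := hE z hz
    have hr := hRl z hz h0
    have hz0 := hR0 z hz
    rw [logDeriv_apply] at hr
    have := (h.fun_div (hR z hz).hasDerivAt hz0).deriv
    rw [this]
    have : d * R z - E z * deriv R z = 0 := by
      apply mul_left_cancel₀ h0
      rw [← hr] at e
      field_simp at e
      linear_combination z * e
    rw [this, zero_div]
  -- At q = 0 the hypotheses on q d/dq are empty, so the vanishing of the derivative there comes by
  -- continuity.
  have hc : Set.EqOn (deriv fun q => E q / R q) 0 (Metric.ball 0 1) := by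
    intro z hz
    rcases eq_or_ne z 0 with rfl | h0
    · have hcont := ((hd.deriv Metric.isOpen_ball).continuousOn.continuousAt
        (Metric.isOpen_ball.mem_nhds hz)).tendsto.mono_left (nhdsWithin_le_nhds (s := {0}ᶜ))
      refine tendsto_nhds_unique hcont (tendsto_const_nhds.congr' ?_)
      filter_upwards [self_mem_nhdsWithin, nhdsWithin_le_nhds (Metric.isOpen_ball.mem_nhds hz)]
        with w h1 h2
      exact (hne w h2 h1).symm
    · exact hne z hz h0
  have h00 : (0 : ℂ) ∈ Metric.ball (0 : ℂ) 1 := by simp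
  have hqm : q ∈ Metric.ball (0 : ℂ) 1 := by simpa using hq
  have := Metric.isOpen_ball.is_const_of_deriv_eq_zero (convex_ball (0 : ℂ) 1).isPreconnected
    hd hc hqm h00
  rw [div_eq_div_iff (hR0 q hq) (hR0 0 (by simp))] at this
  exact this

/-- The value at `q = 0` of the second Eisenstein series of weight one. -/
def eisConst : ℂ := (1 + zeta5 ^ 2) / (2 * (1 - zeta5 ^ 2))

lemma lam_at_zero (m : ℕ) : lam 0 m = 0 := by
  rcases m with _ | m <;> simp [lam]

lemma lamSq_at_zero (m : ℕ) : lamSq 0 m = 0 := by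
  rcases m with _ | m <;> simp [lamSq]

lemma heatFn_at_zero (x : ℂ) : heatFn 0 x = 0 := by
  simp [heatFn, evenSeries, lamSq_at_zero]

lemma zetaFn_at_zero (x : ℂ) : zetaFn 0 x = (1 + x) / (2 * (1 - x)) := by
  simp [zetaFn, oddSeries, lam_at_zero]

lemma logV_at_zero : logV 0 = 0 := by
  simp [logV, heatFn_at_zero, lamSq_at_zero]

lemma zetaFn_zeta5_at_zero : zetaFn 0 zeta5 = (2 + (√5 : ℝ)) * eisConst := by
  have h1 : 1 - zeta5 ≠ 0 := sub_ne_zero.mpr zeta5_ne_one.symm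
  have h2 : 1 - zeta5 ^ 2 ≠ 0 := sub_ne_zero.mpr zeta5_sq_ne_one.symm
  have h3 := zeta5_sq
  have s := sqrt_five_sq
  rw [zetaFn_at_zero, eisConst, div_eq_iff (mul_ne_zero two_ne_zero h1)]
  field_simp
  have : (1 + zeta5) * (1 + zeta5) = (2 + (√5 : ℝ)) * (1 + zeta5 ^ 2) := by
    linear_combination (-1 - (√5 : ℝ)) * h3 - zeta5 / 2 * s
  linear_combination (1 - zeta5) * this

lemma zetaFn_zeta5_sq_at_zero : zetaFn 0 (zeta5 ^ 2) = eisConst := zetaFn_at_zero _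

/-- The Fay relation at q = 0, where the heat terms vanish and ζ(ε) = (2 + √5) ζ(ε²). -/
lemma eisConst_sq : 4 * (5 + 2 * (√5 : ℝ)) * eisConst ^ 2 = -1 := by
  have h := heatFn_relation_two (q := 0) (by simp)
  rw [zetaFn_zeta5_at_zero, zetaFn_zeta5_sq_at_zero, heatFn_at_zero, heatFn_at_zero] at h
  linear_combination 4 * h

lemma sqrt_five_ne_zero : ((√5 : ℝ) : ℂ) ≠ 0 := by
  intro h
  have := sqrt_five_sq
  rw [h] at this
  norm_num at this

lemma eisConst_sq_eq : eisConst ^ 2 = (2 * (√5 : ℝ) - 5) / 20 := by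
  linear_combination (5 - 2 * (√5 : ℝ)) / 20 * eisConst_sq + 4 / 5 * eisConst ^ 2 * sqrt_five_sq

lemma eisW_at_zero_sq :
    (7 + 3 * (√5 : ℝ)) ^ 2 * eisConst ^ 2 = -(25 + 11 * (√5 : ℝ)) / 10 := by
  rw [eisConst_sq_eq]
  linear_combination (18 * (√5 : ℝ) + 39) / 20 * sqrt_five_sq

lemma eisV_mul_eisW_at_zero :
    (7 + 3 * (√5 : ℝ)) * ((√5 : ℝ) - 1) * eisConst ^ 2 = -(√5 : ℝ) / 5 := by
  rw [eisConst_sq_eq]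
  linear_combination (6 * (√5 : ℝ) - 7) / 20 * sqrt_five_sq

lemma eisV_at_zero_sq :
    ((√5 : ℝ) - 1) ^ 2 * eisConst ^ 2 = (11 * (√5 : ℝ) - 25) / 10 := by
  rw [eisConst_sq_eq]
  linear_combination (2 * (√5 : ℝ) - 9) / 20 * sqrt_five_sq

lemma eisConst_ne_zero : eisConst ≠ 0 := by
  intro h
  have := eisConst_sq
  rw [h] at this
  norm_num at this

lemma eisV_at_zero : eisV 0 = ((√5 : ℝ) - 1) * eisConst := by
  rw [eisV, zetaFn_zeta5_at_zero, zetaFn_zeta5_sq_at_zero]; ring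

lemma eisW_at_zero : eisW 0 = (7 + 3 * (√5 : ℝ)) * eisConst := by
  rw [eisW, zetaFn_zeta5_at_zero, zetaFn_zeta5_sq_at_zero]; ring

/-- `V` as a function of the nome. -/
def nomeV (q : ℂ) : ℂ := rootProduct zeta5 (zeta5 ^ 2) q

/-- `W` as a function of the nome. -/
def nomeW (q : ℂ) : ℂ := rootProduct (zeta5 ^ 2) zeta5 q

lemma nomeV_at_zero : nomeV 0 = 1 := rootProduct_zero _ _

lemma nomeW_at_zero : nomeW 0 = 1 := rootProduct_zero _ _

section

variable {q : ℂ} (hq : ‖q‖ < 1)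
include hq

lemma nomeV_ne_zero : nomeV q ≠ 0 := rootProduct_ne_zero norm_zeta5 norm_zeta5_sq hq

lemma nomeW_ne_zero : nomeW q ≠ 0 := rootProduct_ne_zero norm_zeta5_sq norm_zeta5 hq

lemma differentiableAt_nomeV : DifferentiableAt ℂ nomeV q :=
  differentiableAt_rootProduct norm_zeta5 norm_zeta5_sq hq

lemma differentiableAt_nomeW : DifferentiableAt ℂ nomeW q :=
  differentiableAt_rootProduct norm_zeta5_sq norm_zeta5 hq

lemma mul_logDeriv_nomeV (h0 : q ≠ 0) : q * logDeriv nomeV q = logV q :=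
  mul_logDeriv_rootProduct norm_zeta5 norm_zeta5_sq hq h0

lemma mul_logDeriv_nomeW (h0 : q ≠ 0) : q * logDeriv nomeW q = logW q := by
  have := mul_logDeriv_rootProduct norm_zeta5_sq norm_zeta5 hq h0
  have e : nomeW = rootProduct (zeta5 ^ 2) zeta5 := rfl
  rw [logW, e, this]
  ring

lemma eisV_eq : eisV q = ((√5 : ℝ) - 1) * eisConst * nomeV q := by
  have := mul_eq_mul_of_logDeriv_eq (E := eisV) (R := nomeV) (l := logV)
    (fun q hq => by obtain ⟨d, h1, h2, -⟩ := hasDerivAt_eisV hq; exact ⟨d, h1, h2⟩)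
    (fun q hq => differentiableAt_nomeV hq) (fun q hq => nomeV_ne_zero hq)
    (fun q hq h0 => mul_logDeriv_nomeV hq h0) hq
  rwa [nomeV_at_zero, mul_one, eisV_at_zero] at this

lemma eisW_eq : eisW q = (7 + 3 * (√5 : ℝ)) * eisConst * nomeW q := by
  have := mul_eq_mul_of_logDeriv_eq (E := eisW) (R := nomeW) (l := logW)
    (fun q hq => by obtain ⟨d, h1, h2, -⟩ := hasDerivAt_eisW hq; exact ⟨d, h1, h2⟩)
    (fun q hq => differentiableAt_nomeW hq) (fun q hq => nomeW_ne_zero hq)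
    (fun q hq h0 => mul_logDeriv_nomeW hq h0) hq
  rwa [nomeW_at_zero, mul_one, eisW_at_zero] at this

/-- The quadratic relation for the logarithmic derivative of `W / V`. -/
lemma logW_sub_logV_eq : logW q - logV q = (nomeW q - nomeV q)
    * ((25 - 11 * (√5 : ℝ)) / 50 * nomeV q + (25 + 11 * (√5 : ℝ)) / 50 * nomeW q) := by
  have h := logW_sub_logV hq
  have h1 : logW q - logV q = (-eisW q ^ 2 + 11 * eisW q * eisV q + eisV q ^ 2) / 5 := by
    rw [h, eisV, eisW]; ring
  rw [h1, eisV_eq hq, eisW_eq hq]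
  linear_combination -nomeW q ^ 2 / 5 * eisW_at_zero_sq
    + 11 / 5 * nomeV q * nomeW q * eisV_mul_eisW_at_zero + nomeV q ^ 2 / 5 * eisV_at_zero_sq

lemma mul_deriv_logV : ∃ d, HasDerivAt logV d q ∧ q * d = logV q ^ 2
    - (nomeW q - nomeV q) * nomeW q
      * ((25 - 11 * (√5 : ℝ)) / 50 * nomeV q + (25 + 11 * (√5 : ℝ)) / 50 * nomeW q)
      / (5 * (√5 : ℝ)) * (5 * (25 + 11 * (√5 : ℝ)) / 2 * ((nomeW q - nomeV q) / (5 * (√5 : ℝ)))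
        + 5 * (1 + (√5 : ℝ)) / 2 * nomeV q) := by
  obtain ⟨d, h, e⟩ := hasDerivAt_logV hq
  refine ⟨d, h, ?_⟩
  have k : ∀ x : ℂ, x / (5 * (√5 : ℝ)) = x * (√5 : ℝ) / 25 := fun x => by
    have := sqrt_five_ne_zero
    field_simp
    linear_combination -5 * x * sqrt_five_sq
  rw [e, logW_sub_logV_eq hq, eisV_eq hq, eisW_eq hq]
  simp only [k]
  have p1 := eisW_at_zero_sq
  have p2 := eisV_mul_eisW_at_zero
  have s := sqrt_five_sq
  generalize nomeV q = V at *
  generalize nomeW q = W at *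
  generalize ((√5 : ℝ) : ℂ) = r at *
  linear_combination (W - V) * ((25 - 11 * r) / 50 * V + (25 + 11 * r) / 50 * W)
    * ((W ^ 2 * p1 - 3 * V * W * p2) / 5
      + ((W - V) * W * (25 + 11 * r) / 250 + W * V / 10) * s)

end

/-! ### Passage to the upper half plane: the differential system and the nonvanishing of its
factors. -/

/-- A solution of a linear homogeneous first order equation with a zero vanishes identically. -/
lemma eqOn_zero_of_linear_ode {U : Set ℂ} (hU : IsOpen U) (hU' : IsPreconnected U)
    {y g : ℂ → ℂ} (hg : DifferentiableOn ℂ g U) (hy : ∀ z ∈ U, HasDerivAt y (y z * g z) z)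
    {z₀ : ℂ} (hz₀ : z₀ ∈ U) (h0 : y z₀ = 0) : Set.EqOn y 0 U := by
  have hyd : DifferentiableOn ℂ y U := fun z hz => (hy z hz).differentiableAt.differentiableWithinAt
  have ya := hyd.analyticOnNhd hU
  have ga := hg.analyticOnNhd hU
  -- Differentiation lowers a finite positive order of vanishing by one, whereas y g vanishes at
  -- least as much as y; so the order is infinite.
  have ho := (ya z₀ hz₀).analyticOrderAt_deriv_add_one
  have he : deriv y =ᶠ[𝓝 z₀] y * g := by
    filter_upwards [hU.mem_nhds hz₀] with z hz
    exact (hy z hz).deriv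
  rw [analyticOrderAt_congr he, analyticOrderAt_mul (ya z₀ hz₀) (ga z₀ hz₀)] at ho
  simp only [h0, sub_zero] at ho
  have htop : analyticOrderAt y z₀ = ⊤ := by
    by_contra hne
    have h1 : analyticOrderAt y z₀ + 1 ≤ analyticOrderAt y z₀ := by
      calc analyticOrderAt y z₀ + 1 ≤ analyticOrderAt y z₀ + analyticOrderAt g z₀ + 1 := by
            gcongr; exact le_self_add
        _ = _ := ho
    exact absurd ((ENat.add_one_le_iff hne).mp h1) (lt_irrefl _)
  exact ya.eqOn_zero_of_preconnected_of_eventuallyEq_zero hU' hz₀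
    (analyticOrderAt_eq_top.mp htop)

/-- Over ℚ(√5), 1 - y⁵ is (1 - y) times the two quadratic factors of V and W, so the fifth powers
cancel down to a square over a cube. -/
lemma productFactor_eq_rootFactor {y : ℂ} (hy : ‖y‖ < 1) :
    (1 - y) ^ 5 / (1 - y ^ 5) ^ 3 * (1 + (1 - (√5 : ℝ)) / 2 * y + y ^ 2) ^ 5
      = rootFactor zeta5 (zeta5 ^ 2) y ∧
    (1 - y) ^ 5 / (1 - y ^ 5) ^ 3 * (1 + (1 + (√5 : ℝ)) / 2 * y + y ^ 2) ^ 5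
      = rootFactor (zeta5 ^ 2) zeta5 y := by
  have s := sqrt_five_sq
  have hz := zeta5_ne_zero
  have ha := zeta5_add_inv
  have hi : zeta5 * zeta5⁻¹ = 1 := mul_inv_cancel₀ hz
  have n0 := one_sub_mul_ne_zero norm_one hy
  rw [one_mul] at n0
  have n1 := one_sub_mul_ne_zero norm_zeta5 hy
  have n2 := one_sub_mul_ne_zero (t := zeta5⁻¹) (by simp [norm_zeta5]) hy
  have n3 := one_sub_mul_ne_zero norm_zeta5_sq hy
  have n4 := one_sub_mul_ne_zero (t := (zeta5 ^ 2)⁻¹) (by simp [norm_zeta5]) hy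
  have n12 := mul_ne_zero n1 n2
  have n34 := mul_ne_zero n3 n4
  have h1 : (1 - zeta5 * y) * (1 - zeta5⁻¹ * y) = 1 + (1 - (√5 : ℝ)) / 2 * y + y ^ 2 := by
    linear_combination -y * ha + y ^ 2 * hi
  have h2 : (1 - zeta5 ^ 2 * y) * (1 - (zeta5 ^ 2)⁻¹ * y)
      = 1 + (1 + (√5 : ℝ)) / 2 * y + y ^ 2 := by
    rw [← inv_pow]
    linear_combination (-y * (zeta5 + zeta5⁻¹ + ((√5 : ℝ) - 1) / 2)) * ha
      + (2 * y + y ^ 2 * (zeta5 * zeta5⁻¹ + 1)) * hi - y / 4 * s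
  rw [rootFactor, rootFactor, h1, h2]
  rw [h1] at n12
  rw [h2] at n34
  have h3 : 1 - y ^ 5 = (1 - y) * ((1 + (1 - (√5 : ℝ)) / 2 * y + y ^ 2)
      * (1 + (1 + (√5 : ℝ)) / 2 * y + y ^ 2)) := by
    linear_combination (y ^ 2 * (1 - y)) / 4 * s
  rw [h3]
  generalize 1 + (1 - ((√5 : ℝ) : ℂ)) / 2 * y + y ^ 2 = a at *
  generalize 1 + (1 + ((√5 : ℝ) : ℂ)) / 2 * y + y ^ 2 = b at *
  generalize 1 - y = c at *
  constructor <;> field_simp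

lemma norm_nome (τ : ℂ) : ‖nome τ‖ = Real.exp (-(2 * Real.pi * τ.im)) := by
  rw [nome, Complex.norm_exp]
  congr 1
  simp

lemma norm_nome_lt_one {τ : ℂ} (hτ : 0 < τ.im) : ‖nome τ‖ < 1 := by
  rw [norm_nome, Real.exp_lt_one_iff]
  have := Real.pi_pos
  have : 0 < 2 * Real.pi * τ.im := by positivity
  linarith

lemma nome_ne_zero (τ : ℂ) : nome τ ≠ 0 := Complex.exp_ne_zero _

lemma hasDerivAt_nome (τ : ℂ) :
    HasDerivAt nome (2 * Real.pi * Complex.I * nome τ) τ := by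
  have h := ((hasDerivAt_id τ).const_mul (2 * Real.pi * Complex.I)).cexp
  refine h.congr_deriv ?_
  simp only [id, mul_one, nome]
  ring

lemma tendsto_nome : Tendsto nome (comap Complex.im atTop) (𝓝 0) := by
  rw [tendsto_zero_iff_norm_tendsto_zero]
  simp only [norm_nome]
  refine Real.tendsto_exp_atBot.comp (tendsto_neg_atTop_atBot.comp ?_)
  exact tendsto_comap.const_mul_atTop (by positivity)

lemma exists_nome_eq {q : ℂ} (h0 : q ≠ 0) (hq : ‖q‖ < 1) : ∃ τ : ℂ, 0 < τ.im ∧ nome τ = q := by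
  have hk : (2 * Real.pi * Complex.I : ℂ) ≠ 0 := Complex.two_pi_I_ne_zero
  have hn : nome (Complex.log q / (2 * Real.pi * Complex.I)) = q := by
    rw [nome, mul_div_cancel₀ _ hk, Complex.exp_log h0]
  refine ⟨_, ?_, hn⟩
  by_contra hneg
  rw [← hn, norm_nome, Real.exp_lt_one_iff] at hq
  have := mul_nonpos_of_nonneg_of_nonpos (a := 2 * Real.pi) (by positivity) (not_lt.mp hneg)
  linarith

lemma V_eq {τ : ℂ} (hτ : 0 < τ.im) : V τ = nomeV (nome τ) := by
  rw [V, thetaProduct, nomeV, rootProduct]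
  refine tprod_congr fun n => ?_
  rw [← (productFactor_eq_rootFactor _).1, ← pow_mul', ← pow_mul']
  rw [norm_pow]
  exact pow_lt_one₀ (norm_nonneg _) (norm_nome_lt_one hτ) n.succ_ne_zero

lemma W_eq {τ : ℂ} (hτ : 0 < τ.im) : W τ = nomeW (nome τ) := by
  rw [W, thetaProduct, nomeW, rootProduct]
  refine tprod_congr fun n => ?_
  rw [← (productFactor_eq_rootFactor _).2, ← pow_mul', ← pow_mul']
  rw [norm_pow]
  exact pow_lt_one₀ (norm_nonneg _) (norm_nome_lt_one hτ) n.succ_ne_zero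

/-- The weight one form `((25 - 11 √5) V + (25 + 11 √5) W) / 50`. -/
def U (τ : ℂ) : ℂ :=
  (25 - 11 * (√5 : ℝ)) / 50 * V τ + (25 + 11 * (√5 : ℝ)) / 50 * W τ

/-- The logarithmic derivative of `V` with respect to `2 π i τ`. -/
def L (τ : ℂ) : ℂ := logV (nome τ)

/-- The upper half plane as an open set of complex numbers. -/
def upper : Set ℂ := {τ : ℂ | 0 < τ.im}

lemma isOpen_upper : IsOpen upper := isOpen_lt continuous_const Complex.continuous_im

lemma isPreconnected_upper : IsPreconnected upper :=
  (convex_halfSpace_im_gt 0).isPreconnected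

/-- The constant `2 π i`. -/
def twoPiI : ℂ := 2 * Real.pi * Complex.I

lemma twoPiI_ne_zero : twoPiI ≠ 0 := Complex.two_pi_I_ne_zero

lemma upper_mem_nhds {τ : ℂ} (hτ : 0 < τ.im) : upper ∈ 𝓝 τ := isOpen_upper.mem_nhds hτ

section

variable {τ : ℂ} (hτ : 0 < τ.im)
include hτ

lemma V_ne_zero : V τ ≠ 0 := by
  rw [V_eq hτ]; exact nomeV_ne_zero (norm_nome_lt_one hτ)

lemma W_ne_zero : W τ ≠ 0 := by
  rw [W_eq hτ]; exact nomeW_ne_zero (norm_nome_lt_one hτ)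

lemma hasDerivAt_V : HasDerivAt V (twoPiI * (V τ * L τ)) τ := by
  have hq := norm_nome_lt_one hτ
  have h := (differentiableAt_nomeV hq).hasDerivAt.comp τ (hasDerivAt_nome τ)
  refine (h.congr_of_eventuallyEq ?_).congr_deriv ?_
  · filter_upwards [upper_mem_nhds hτ] with t ht using V_eq ht
  · rw [V_eq hτ, L, ← mul_logDeriv_nomeV hq (nome_ne_zero τ), logDeriv_apply, twoPiI]
    have := nomeV_ne_zero hq
    field_simp

lemma hasDerivAt_W :
    HasDerivAt W (twoPiI * (W τ * (L τ + (W τ - V τ) * U τ))) τ := by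
  have hq := norm_nome_lt_one hτ
  have h := (differentiableAt_nomeW hq).hasDerivAt.comp τ (hasDerivAt_nome τ)
  refine (h.congr_of_eventuallyEq ?_).congr_deriv ?_
  · filter_upwards [upper_mem_nhds hτ] with t ht using W_eq ht
  · have e : L τ + (W τ - V τ) * U τ = logW (nome τ) := by
      rw [L, U, V_eq hτ, W_eq hτ, ← logW_sub_logV_eq hq]; ring
    rw [e, W_eq hτ, ← mul_logDeriv_nomeW hq (nome_ne_zero τ), logDeriv_apply, twoPiI]
    have := nomeW_ne_zero hq
    field_simp

lemma hasDerivAt_L : HasDerivAt L (twoPiI * (L τ ^ 2 - (W τ - V τ) * W τ * U τ / (5 * (√5 : ℝ))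
    * (5 * (25 + 11 * (√5 : ℝ)) / 2 * ((W τ - V τ) / (5 * (√5 : ℝ)))
      + 5 * (1 + (√5 : ℝ)) / 2 * V τ))) τ := by
  have hq := norm_nome_lt_one hτ
  obtain ⟨d, h, e⟩ := mul_deriv_logV hq
  refine (h.comp τ (hasDerivAt_nome τ)).congr_deriv ?_
  rw [L, U, V_eq hτ, W_eq hτ, ← e, twoPiI]
  ring

lemma hasDerivAt_U :
    HasDerivAt U (U τ * (twoPiI * (L τ + (25 + 11 * (√5 : ℝ)) / 50 * W τ * (W τ - V τ)))) τ := by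
  refine (((hasDerivAt_V hτ).const_mul ((25 - 11 * (√5 : ℝ) : ℂ) / 50)).add
    ((hasDerivAt_W hτ).const_mul ((25 + 11 * (√5 : ℝ) : ℂ) / 50))).congr_deriv ?_
  rw [U]; ring

lemma hasDerivAt_W_sub_V : HasDerivAt (fun τ => W τ - V τ)
    ((W τ - V τ) * (twoPiI * (L τ + W τ * U τ))) τ := by
  refine ((hasDerivAt_W hτ).sub (hasDerivAt_V hτ)).congr_deriv ?_
  ring

lemma U_ne_zero : U τ ≠ 0 := by
  intro h0
  have hz := eqOn_zero_of_linear_ode isOpen_upper isPreconnected_upper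
    (g := fun τ => twoPiI * (L τ + (25 + 11 * (√5 : ℝ)) / 50 * W τ * (W τ - V τ)))
    (fun t ht => by
      have h1 := (hasDerivAt_V ht).differentiableAt
      have h2 := (hasDerivAt_W ht).differentiableAt
      have h3 := (hasDerivAt_L ht).differentiableAt
      exact DifferentiableAt.differentiableWithinAt (by fun_prop))
    (fun t ht => hasDerivAt_U ht) hτ h0
  -- If U vanished identically, so would its limit at the cusp; but that limit is 1, the sum of the
  -- two coefficients.
  have h1 : ContinuousAt (fun q => (25 - 11 * (√5 : ℝ) : ℂ) / 50 * nomeV q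
      + (25 + 11 * (√5 : ℝ)) / 50 * nomeW q) 0 :=
    ((differentiableAt_nomeV (by simp)).continuousAt.const_mul _).add
      ((differentiableAt_nomeW (by simp)).continuousAt.const_mul _)
  have h2 := tendsto_nhds_unique (h1.tendsto.mono_left (nhdsWithin_le_nhds (s := {0}ᶜ)))
    (tendsto_const_nhds (x := (0 : ℂ)) |>.congr' (by
      filter_upwards [self_mem_nhdsWithin,
        nhdsWithin_le_nhds (Metric.ball_mem_nhds (0 : ℂ) one_pos)] with q hq0 hq
      obtain ⟨t, ht, rfl⟩ := exists_nome_eq hq0 (by simpa using hq)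
      have := hz ht
      rw [U, V_eq ht, W_eq ht] at this
      exact this.symm))
  rw [nomeV_at_zero, nomeW_at_zero] at h2
  norm_num at h2
  have : (50 : ℂ) = 0 := by linear_combination 50 * h2
  norm_num at this

lemma W_sub_V_ne_zero : W τ - V τ ≠ 0 := by
  intro h0
  have hz := eqOn_zero_of_linear_ode isOpen_upper isPreconnected_upper
    (y := fun τ => W τ - V τ) (g := fun τ => twoPiI * (L τ + W τ * U τ))
    (fun t ht => by
      have h1 := (hasDerivAt_U ht).differentiableAt
      have h2 := (hasDerivAt_W ht).differentiableAt
      have h3 := (hasDerivAt_L ht).differentiableAt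
      exact DifferentiableAt.differentiableWithinAt (by fun_prop))
    (fun t ht => hasDerivAt_W_sub_V ht) hτ h0
  have heq : ∀ q : ℂ, ‖q‖ < 1 → nomeW q = nomeV q := fun q hq => by
    rcases eq_or_ne q 0 with rfl | hq0
    · rw [nomeV_at_zero, nomeW_at_zero]
    · obtain ⟨t, ht, rfl⟩ := exists_nome_eq hq0 hq
      rw [← V_eq ht, ← W_eq ht]
      exact sub_eq_zero.mp (hz ht)
  -- V and W agree at the cusp, so the contradiction has to come from the first Fourier
  -- coefficients, read off from the Eisenstein series.
  obtain ⟨d1, h1, -, e1⟩ := hasDerivAt_eisV (q := 0) (by simp)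
  obtain ⟨d2, h2, -, e2⟩ := hasDerivAt_eisW (q := 0) (by simp)
  have hd := (h1.const_mul (eisW 0)).unique ((h2.const_mul (eisV 0)).congr_of_eventuallyEq (by
    filter_upwards [Metric.ball_mem_nhds (0 : ℂ) one_pos] with q hq
    rw [mem_ball_zero_iff] at hq
    rw [eisV_eq hq, eisW_eq hq, heq q hq, eisV_at_zero, eisW_at_zero]
    ring))
  rw [e1 rfl, e2 rfl, eisV_at_zero, eisW_at_zero, ← inv_pow] at hd
  have ha := zeta5_add_inv
  have hb : zeta5 ^ 2 - zeta5⁻¹ ^ 2 = ((√5 : ℝ) - 1) / 2 * (zeta5 - zeta5⁻¹) := by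
    rw [← ha]; ring
  rw [hb] at hd
  have s := sqrt_five_sq
  have hfin : (5 + 5 * (√5 : ℝ)) * eisConst * (zeta5 - zeta5⁻¹) = 0 := by
    linear_combination -hd - 5 * eisConst * (zeta5 - zeta5⁻¹) * s
  have h5 : (5 + 5 * (√5 : ℝ) : ℂ) ≠ 0 := by
    have : (5 + 5 * √5 : ℝ) ≠ 0 := by positivity
    exact_mod_cast this
  have hdelta : zeta5 - zeta5⁻¹ ≠ 0 := by
    intro h
    apply zeta5_sq_ne_one
    have := zeta5_ne_zero
    field_simp at h
    linear_combination h
  exact mul_ne_zero (mul_ne_zero h5 eisConst_ne_zero) hdelta hfin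

lemma v_eq : v τ = (W τ - V τ) / (5 * (√5 : ℝ) * V τ) := by
  have := V_ne_zero hτ
  have := sqrt_five_ne_zero
  rw [v]; field_simp

lemma one_add_v : 1 + 5 * (√5 : ℝ) * v τ = W τ / V τ := by
  have := V_ne_zero hτ
  have := sqrt_five_ne_zero
  rw [v_eq hτ]; field_simp; ring

lemma one_add_v' : 1 + (11 + 5 * (√5 : ℝ)) / 2 * v τ = U τ / V τ := by
  have := V_ne_zero hτ
  have := sqrt_five_ne_zero
  have s := sqrt_five_sq
  rw [v_eq hτ, U]; field_simp
  linear_combination -110 * (W τ - V τ) * s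

/-- The cubic polynomial in the differential equation of `v`. -/
def cubic (x : ℂ) : ℂ := x * (1 + 5 * (√5 : ℝ) * x) * (1 + (11 + 5 * (√5 : ℝ)) / 2 * x)

lemma cubic_v : V τ ^ 3 * cubic (v τ) = (W τ - V τ) * W τ * U τ / (5 * (√5 : ℝ)) := by
  have := V_ne_zero hτ
  have := sqrt_five_ne_zero
  rw [cubic, one_add_v hτ, one_add_v' hτ, v_eq hτ]; field_simp

lemma cubic_v_ne_zero : cubic (v τ) ≠ 0 := by
  intro h
  have := cubic_v hτ
  rw [h, mul_zero, eq_comm, div_eq_zero_iff] at this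
  rcases this with h1 | h1
  · exact mul_ne_zero (mul_ne_zero (W_sub_V_ne_zero hτ) (W_ne_zero hτ)) (U_ne_zero hτ) h1
  · exact mul_ne_zero (by norm_num) sqrt_five_ne_zero h1

/-- The terms in L cancel in the quotient (W - V)/V, leaving (W - V) W U / V, which `cubic_v`
rewrites. -/
lemma hasDerivAt_v : HasDerivAt v (twoPiI * (V τ ^ 2 * cubic (v τ))) τ := by
  have hV := V_ne_zero hτ
  have h5 := sqrt_five_ne_zero
  refine (((hasDerivAt_W_sub_V hτ).fun_div (hasDerivAt_V hτ) hV).const_mul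
    (1 / (5 * ((√5 : ℝ) : ℂ)))).congr_deriv ?_
  have e : V τ ^ 2 * cubic (v τ) = (W τ - V τ) * W τ * U τ / (5 * (√5 : ℝ)) / V τ := by
    rw [← cubic_v hτ]; field_simp
  rw [e]
  field_simp
  ring

lemma hasDerivAt_L' : HasDerivAt L (twoPiI * (L τ ^ 2 - V τ ^ 4 * cubic (v τ)
    * (5 * (25 + 11 * (√5 : ℝ)) / 2 * v τ + 5 * (1 + (√5 : ℝ)) / 2))) τ := by
  refine (hasDerivAt_L hτ).congr_deriv ?_
  rw [← cubic_v hτ]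
  have hV := V_ne_zero hτ
  have e : (W τ - V τ) / (5 * (√5 : ℝ)) = V τ * v τ := by
    have h5 := sqrt_five_ne_zero
    rw [v_eq hτ]; field_simp
  rw [e]; ring

end

/-! ### Inverse branches of v and Heun's equation. -/

/-- The roots are simplified with (11 + 5√5)(11 - 5√5) = -4 and 1/(5√5) = √5/25. -/
lemma cubic_eq (x : ℂ) : cubic x = (125 + 55 * (√5 : ℝ)) / 2
    * (x * (x + (√5 : ℝ) / 25) * (x - (11 - 5 * (√5 : ℝ)) / 2)) := by
  have s := sqrt_five_sq
  rw [cubic]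
  generalize ((√5 : ℝ) : ℂ) = r at *
  linear_combination (-x / 5 - 11 * r * x / 4 - 1397 / 20 * x ^ 2 + 25 / 2 * x ^ 3) * s

lemma hasDerivAt_cubic (x : ℂ) : HasDerivAt cubic ((125 + 55 * (√5 : ℝ)) / 2
    * ((x + (√5 : ℝ) / 25) * (x - (11 - 5 * (√5 : ℝ)) / 2)
      + x * (x - (11 - 5 * (√5 : ℝ)) / 2) + x * (x + (√5 : ℝ) / 25))) x := by
  have h := (((hasDerivAt_id' x).fun_mul ((hasDerivAt_id' x).add_const ((√5 : ℝ) / 25 : ℂ))).fun_mul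
    ((hasDerivAt_id' x).sub_const ((11 - 5 * (√5 : ℝ)) / 2 : ℂ))).const_mul
    ((125 + 55 * (√5 : ℝ)) / 2 : ℂ)
  refine (h.congr_of_eventuallyEq (.of_forall fun y => cubic_eq y)).congr_deriv ?_
  ring

lemma linear_eq (x : ℂ) : 5 * (25 + 11 * (√5 : ℝ)) / 2 * x + 5 * (1 + (√5 : ℝ)) / 2
    = (125 + 55 * (√5 : ℝ)) / 2 * (x - (15 - 7 * (√5 : ℝ)) / 10) := by
  linear_combination -77 / 4 * sqrt_five_sq

lemma exists_inverseBranch {τ₀ : ℂ} (h₀ : 0 < τ₀.im) : ∃ (Ω : Set ℂ) (σ : ℂ → ℂ),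
    IsInverseBranch Ω σ ∧ v τ₀ ∈ Ω ∧ σ (v τ₀) = τ₀ := by
  have hd : DifferentiableOn ℂ v upper := fun t ht =>
    (hasDerivAt_v ht).differentiableAt.differentiableWithinAt
  have hne : ∀ t : ℂ, 0 < t.im → twoPiI * (V t ^ 2 * cubic (v t)) ≠ 0 := fun t ht =>
    mul_ne_zero twoPiI_ne_zero (mul_ne_zero (pow_ne_zero 2 (V_ne_zero ht)) (cubic_v_ne_zero ht))
  have hs : HasStrictDerivAt v (twoPiI * (V τ₀ ^ 2 * cubic (v τ₀))) τ₀ := by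
    have ha := hd.analyticAt (upper_mem_nhds h₀)
    rw [← (hasDerivAt_v h₀).deriv]
    exact ha.hasStrictDerivAt
  have hf := hs.hasStrictFDerivAt_equiv (hne _ h₀)
  set R := hf.toOpenPartialHomeomorph v with hR
  have hcoe : (R : ℂ → ℂ) = v := hf.toOpenPartialHomeomorph_coe
  have hsrc : τ₀ ∈ R.source := hf.mem_toOpenPartialHomeomorph_source
  have hinv : R.symm (v τ₀) = τ₀ := by rw [← hcoe]; exact R.left_inv hsrc
  have hv : ∀ x ∈ R.target, v (R.symm x) = x := fun x hx => by
    rw [← hcoe]; exact R.right_inv hx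
  -- The target of the local homeomorphism is cut down so that the inverse takes values in the upper
  -- half plane.
  refine ⟨R.target ∩ R.symm ⁻¹' upper, R.symm, ⟨R.isOpen_inter_preimage_symm isOpen_upper,
    fun x hx => ?_, fun x hx => hx.2, fun x hx => hv x hx.1⟩, ⟨?_, ?_⟩, hinv⟩
  · have := R.hasDerivAt_symm hx.1 (hne _ hx.2) (by rw [hcoe]; exact hasDerivAt_v hx.2)
    exact this.differentiableAt.differentiableWithinAt
  · rw [← hcoe]; exact R.map_source hsrc
  · show R.symm (v τ₀) ∈ upper
    rw [hinv]; exact h₀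

section Branch

variable {Ω : Set ℂ} {σ : ℂ → ℂ} (h : IsInverseBranch Ω σ)
include h

lemma hasDerivAt_branch {x : ℂ} (hx : x ∈ Ω) :
    HasDerivAt σ (1 / (twoPiI * (V (σ x) ^ 2 * cubic x))) x := by
  have hd := (h.holomorphic.differentiableAt (h.isOpen.mem_nhds hx)).hasDerivAt
  have hp := h.im_pos x hx
  have hc : cubic x ≠ 0 := by have := cubic_v_ne_zero hp; rwa [h.v_apply x hx] at this
  have h1 := (hasDerivAt_v hp).comp x hd
  have h2 : HasDerivAt (v ∘ σ) 1 x := (hasDerivAt_id x).congr_of_eventuallyEq (by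
    filter_upwards [h.isOpen.mem_nhds hx] with y hy using h.v_apply y hy)
  have h3 := h1.unique h2
  rw [h.v_apply x hx] at h3
  refine hd.congr_deriv ?_
  rw [eq_div_iff (mul_ne_zero twoPiI_ne_zero (mul_ne_zero (pow_ne_zero 2 (V_ne_zero hp)) hc)),
    ← h3]
  ring

lemma hasDerivAt_V_branch {x : ℂ} (hx : x ∈ Ω) :
    HasDerivAt (fun x => V (σ x)) (L (σ x) / (V (σ x) * cubic x)) x := by
  have hp := h.im_pos x hx
  have hV := V_ne_zero hp
  have hk := twoPiI_ne_zero
  have hc : cubic x ≠ 0 := by have := cubic_v_ne_zero hp; rwa [h.v_apply x hx] at this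
  refine ((hasDerivAt_V hp).comp x (hasDerivAt_branch h hx)).congr_deriv ?_
  field_simp

lemma branch_point_ne {x : ℂ} (hx : x ∈ Ω) :
    x ≠ 0 ∧ x + (√5 : ℝ) / 25 ≠ 0 ∧ x - (11 - 5 * (√5 : ℝ)) / 2 ≠ 0 := by
  have hp := h.im_pos x hx
  have hc : cubic x ≠ 0 := by have := cubic_v_ne_zero hp; rwa [h.v_apply x hx] at this
  rw [cubic_eq] at hc
  refine ⟨?_, ?_, ?_⟩ <;> intro h0 <;> apply hc <;> rw [h0] <;> ring

/-- By `hasDerivAt_V_branch`, c · dV/dx = L/V; in the derivative of L/V the L² terms cancel and -ℓV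
remains. -/
lemma heunAt_branch {x : ℂ} (hx : x ∈ Ω) : HeunAt (fun x => V (σ x)) x := by
  have hp := h.im_pos x hx
  have hV := V_ne_zero hp
  have hk := twoPiI_ne_zero
  have hc : cubic x ≠ 0 := by have := cubic_v_ne_zero hp; rwa [h.v_apply x hx] at this
  obtain ⟨n1, n2, n3⟩ := branch_point_ne h hx
  have d1 : deriv (fun x => V (σ x)) =ᶠ[𝓝 x] fun x => L (σ x) / (V (σ x) * cubic x) := by
    filter_upwards [h.isOpen.mem_nhds hx] with y hy using (hasDerivAt_V_branch h hy).deriv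
  have dL : HasDerivAt (fun x => L (σ x)) _ x :=
    (hasDerivAt_L' hp).comp x (hasDerivAt_branch h hx)
  have d2 := dL.fun_div ((hasDerivAt_V_branch h hx).fun_mul (hasDerivAt_cubic x))
    (mul_ne_zero hV hc)
  rw [HeunAt, d1.deriv_eq, (hasDerivAt_V_branch h hx).deriv, d2.deriv, h.v_apply x hx,
    linear_eq]
  rw [cubic_eq] at hc ⊢
  have n4 : (125 + 55 * ((√5 : ℝ) : ℂ)) / 2 ≠ 0 := left_ne_zero_of_mul hc
  generalize x - (15 - 7 * ((√5 : ℝ) : ℂ)) / 10 = D at *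
  generalize (125 + 55 * ((√5 : ℝ) : ℂ)) / 2 = e at *
  generalize x + ((√5 : ℝ) : ℂ) / 25 = B at *
  generalize x - (11 - 5 * ((√5 : ℝ) : ℂ)) / 2 = C at *
  generalize V (σ x) = y at *
  generalize L (σ x) = l at *
  clear d1 d2 dL hc
  field_simp
  ring

end Branch

/-! ### Growth of the sequence and its generating function. -/

lemma a₅_recurrence (n : ℕ) :
    ((n : ℝ) + 1) ^ 2 * a₅ (n + 1)
      + ((11 + 15 * √5) / 2 * (n : ℝ) * ((n : ℝ) + 1) + 5 * (1 + √5) / 2) * a₅ n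
      + 5 * (25 + 11 * √5) / 2 * (n : ℝ) ^ 2 * a₅ (n - 1) = 0 := by
  rcases n with _ | n
  · simp [a₅]
  · have h : (n : ℝ) + 2 ≠ 0 := by positivity
    have e : ((n + 1 : ℕ) : ℝ) + 1 = (n : ℝ) + 2 := by push_cast; ring
    rw [e, show n + 1 + 1 = n + 2 from rfl, a₅, Nat.add_sub_cancel]
    push_cast
    field_simp
    ring

/-- The recurrence of `a₅` is a perturbation of one with the constant characteristic roots
`-5 √5` and `-(11 + 5 √5) / 2`. -/
lemma exists_abs_a₅_perturbation : ∃ K, 0 ≤ K ∧ ∀ n : ℕ,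
    |a₅ (n + 2) + (5 * √5 + (11 + 5 * √5) / 2) * a₅ (n + 1)
      + 5 * √5 * ((11 + 5 * √5) / 2) * a₅ n|
      ≤ K / ((n : ℝ) + 2) * (|a₅ (n + 1)| + |a₅ n|) := by
  have s : √5 ^ 2 = 5 := Real.sq_sqrt (by norm_num)
  have s0 : 0 ≤ √5 := Real.sqrt_nonneg 5
  refine ⟨(11 + 15 * √5) / 2 + 5 * (1 + √5) / 2 + 2 * (5 * (25 + 11 * √5) / 2), by positivity,
    fun n => ?_⟩
  have hn : (0 : ℝ) < (n : ℝ) + 2 := by positivity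
  have h := a₅_recurrence (n + 1)
  push_cast at h
  rw [show n + 1 + 1 = n + 2 from rfl] at h
  have e : a₅ (n + 2) + (5 * √5 + (11 + 5 * √5) / 2) * a₅ (n + 1)
      + 5 * √5 * ((11 + 5 * √5) / 2) * a₅ n
      = (((11 + 15 * √5) / 2 * ((n : ℝ) + 2) - 5 * (1 + √5) / 2) * a₅ (n + 1)
        + 5 * (25 + 11 * √5) / 2 * (2 * n + 3) * a₅ n) / ((n : ℝ) + 2) ^ 2 := by
    rw [eq_div_iff (by positivity)]
    linear_combination h + 25 / 2 * ((n : ℝ) + 2) ^ 2 * a₅ n * s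
  rw [e, abs_div, abs_of_pos (by positivity : (0 : ℝ) < ((n : ℝ) + 2) ^ 2), div_le_iff₀
    (by positivity)]
  have h1 : |(11 + 15 * √5) / 2 * ((n : ℝ) + 2) - 5 * (1 + √5) / 2|
      ≤ ((11 + 15 * √5) / 2 + 5 * (1 + √5) / 2) * ((n : ℝ) + 2) := by
    refine (abs_sub _ _).trans ?_
    rw [abs_of_nonneg (by positivity), abs_of_nonneg (by positivity)]
    have : 5 * (1 + √5) / 2 * 1 ≤ 5 * (1 + √5) / 2 * ((n : ℝ) + 2) := by
      gcongr; linarith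
    linarith
  have h2 : |5 * (25 + 11 * √5) / 2 * (2 * (n : ℝ) + 3)|
      ≤ 2 * (5 * (25 + 11 * √5) / 2) * ((n : ℝ) + 2) := by
    rw [abs_of_nonneg (by positivity)]
    nlinarith [mul_nonneg s0 hn.le]
  calc |((11 + 15 * √5) / 2 * ((n : ℝ) + 2) - 5 * (1 + √5) / 2) * a₅ (n + 1)
        + 5 * (25 + 11 * √5) / 2 * (2 * n + 3) * a₅ n|
      ≤ ((11 + 15 * √5) / 2 + 5 * (1 + √5) / 2) * ((n : ℝ) + 2) * |a₅ (n + 1)|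
        + 2 * (5 * (25 + 11 * √5) / 2) * ((n : ℝ) + 2) * |a₅ n| := by
        refine (abs_add_le _ _).trans ?_
        rw [abs_mul, abs_mul _ (a₅ n)]
        gcongr
    _ ≤ _ := by
        have e3 : ∀ A B : ℝ, (A + B) / ((n : ℝ) + 2) * (|a₅ (n + 1)| + |a₅ n|) * ((n : ℝ) + 2) ^ 2
            = (A * ((n : ℝ) + 2) * |a₅ (n + 1)| + B * ((n : ℝ) + 2) * |a₅ n|)
              + (A * ((n : ℝ) + 2) * |a₅ n| + B * ((n : ℝ) + 2) * |a₅ (n + 1)|) := fun A B => by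
          field_simp; ring
        rw [e3]
        have : 0 ≤ ((11 + 15 * √5) / 2 + 5 * (1 + √5) / 2) * ((n : ℝ) + 2) * |a₅ n|
          + 2 * (5 * (25 + 11 * √5) / 2) * ((n : ℝ) + 2) * |a₅ (n + 1)| := by positivity
        linarith

lemma exists_abs_a₅_mul_pow_le {R : ℝ} (hR0 : 0 < R) (hR : R < √5 / 25) :
    ∃ C, ∀ n, |a₅ n| * R ^ n ≤ C := by
  obtain ⟨K, hK0, hK⟩ := exists_abs_a₅_perturbation
  have s : √5 ^ 2 = 5 := Real.sq_sqrt (by norm_num)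
  have s0 : 0 ≤ √5 := Real.sqrt_nonneg 5
  set μ : ℝ := 5 * √5 with hμ
  set ν : ℝ := (11 + 5 * √5) / 2 with hν
  -- The roots are close (about 11.18 and 11.09); strict inequality is what makes the two linear
  -- forms below independent.
  have hμν : 0 < μ - ν := by
    have : 11 / 5 < √5 := by rw [Real.lt_sqrt (by norm_num)]; norm_num
    rw [hμ, hν]; linarith
  have hμ0 : 0 ≤ μ := by positivity
  have hν0 : 0 ≤ ν := by positivity
  have hμR : μ * R < 1 := by
    calc μ * R < μ * (√5 / 25) := by
          have : 0 < μ := by linarith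
          gcongr
      _ = 1 := by rw [hμ]; linear_combination s / 5
  -- A norm adapted to the limiting recurrence: its two forms are multiplied by -μ and -ν at each
  -- step, so N grows by the factor μ + O(1/n). As μ = 25/√5, the ratio test applies for R < √5/25.
  set N : ℕ → ℝ := fun n => |a₅ (n + 1) + ν * a₅ n| + |a₅ (n + 1) + μ * a₅ n| with hN
  have hN0 : ∀ n, 0 ≤ N n := fun n => by positivity
  have ha : ∀ n, |a₅ n| ≤ (μ - ν)⁻¹ * N n := fun n => by
    rw [inv_mul_eq_div, le_div_iff₀ hμν, ← abs_of_pos hμν, ← abs_mul]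
    have : a₅ n * (μ - ν) = (a₅ (n + 1) + μ * a₅ n) - (a₅ (n + 1) + ν * a₅ n) := by ring
    rw [this]
    refine (abs_sub _ _).trans ?_
    rw [hN]; linarith
  have ha1 : ∀ n, |a₅ (n + 1)| ≤ (1 + ν * (μ - ν)⁻¹) * N n := fun n => by
    have : a₅ (n + 1) = (a₅ (n + 1) + ν * a₅ n) - ν * a₅ n := by ring
    rw [this]
    refine (abs_sub _ _).trans ?_
    rw [abs_mul, abs_of_nonneg hν0, add_mul, one_mul, mul_assoc]
    have h1 : |a₅ (n + 1) + ν * a₅ n| ≤ N n := by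
      rw [hN]; linarith [abs_nonneg (a₅ (n + 1) + μ * a₅ n)]
    have h2 := mul_le_mul_of_nonneg_left (ha n) hν0
    linarith
  set c : ℝ := 2 * K * (1 + ν * (μ - ν)⁻¹ + (μ - ν)⁻¹) with hc
  have hstep : ∀ n : ℕ, N (n + 1) ≤ (μ + c / ((n : ℝ) + 2)) * N n := fun n => by
    have hE := hK n
    set E := a₅ (n + 2) + (μ + ν) * a₅ (n + 1) + μ * ν * a₅ n with hEdef
    have h1 : a₅ (n + 1 + 1) + ν * a₅ (n + 1) = E - μ * (a₅ (n + 1) + ν * a₅ n) := by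
      rw [hEdef]; ring
    have h2 : a₅ (n + 1 + 1) + μ * a₅ (n + 1) = E - ν * (a₅ (n + 1) + μ * a₅ n) := by
      rw [hEdef]; ring
    have h3 : N (n + 1) ≤ 2 * |E| + μ * N n := by
      simp only [hN]
      rw [h1, h2]
      have t1 := abs_sub E (μ * (a₅ (n + 1) + ν * a₅ n))
      have t2 := abs_sub E (ν * (a₅ (n + 1) + μ * a₅ n))
      rw [abs_mul, abs_of_nonneg hμ0] at t1
      rw [abs_mul, abs_of_nonneg hν0] at t2
      have t3 : ν * |a₅ (n + 1) + μ * a₅ n| ≤ μ * |a₅ (n + 1) + μ * a₅ n| :=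
        mul_le_mul_of_nonneg_right (by linarith) (abs_nonneg _)
      linarith
    have h4 : |E| ≤ K / ((n : ℝ) + 2) * ((1 + ν * (μ - ν)⁻¹ + (μ - ν)⁻¹) * N n) := by
      refine hE.trans (mul_le_mul_of_nonneg_left ?_ (by positivity))
      have := ha n
      have := ha1 n
      linarith
    calc N (n + 1) ≤ 2 * (K / ((n : ℝ) + 2) * ((1 + ν * (μ - ν)⁻¹ + (μ - ν)⁻¹) * N n))
          + μ * N n := by linarith
      _ = _ := by rw [hc]; ring
  obtain ⟨r, hr1, hr2⟩ := exists_between hμR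
  have hev : ∀ᶠ n : ℕ in atTop, (μ + c / ((n : ℝ) + 2)) * R < r := by
    have h1 : Tendsto (fun n : ℕ => (n : ℝ) + 2) atTop atTop :=
      tendsto_atTop_add_const_right _ _ tendsto_natCast_atTop_atTop
    have h2 := ((h1.const_div_atTop c).const_add μ).mul_const R
    rw [add_zero] at h2
    exact h2.eventually_lt_const hr1
  have hsum : Summable fun n => N n * R ^ n := by
    refine summable_of_ratio_norm_eventually_le hr2 ?_
    filter_upwards [hev] with n hn
    have hp : 0 ≤ N n * R ^ n := mul_nonneg (hN0 n) (by positivity)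
    rw [Real.norm_of_nonneg (mul_nonneg (hN0 _) (by positivity)), Real.norm_of_nonneg hp]
    calc N (n + 1) * R ^ (n + 1) ≤ ((μ + c / ((n : ℝ) + 2)) * N n) * R ^ (n + 1) := by
          gcongr; exact hstep n
      _ = ((μ + c / ((n : ℝ) + 2)) * R) * (N n * R ^ n) := by ring
      _ ≤ r * (N n * R ^ n) := by gcongr
  refine ⟨(μ - ν)⁻¹ * ∑' n, N n * R ^ n, fun n => ?_⟩
  have h1 := hsum.le_tsum n fun m _ => mul_nonneg (hN0 m) (by positivity)
  calc |a₅ n| * R ^ n ≤ ((μ - ν)⁻¹ * N n) * R ^ n := by gcongr; exact ha n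
    _ = (μ - ν)⁻¹ * (N n * R ^ n) := by ring
    _ ≤ _ := by gcongr

lemma summable_a₅ (k : ℕ) {r : ℝ} (hr0 : 0 ≤ r) (hr : r < √5 / 25) :
    Summable fun n : ℕ => (n : ℝ) ^ k * |a₅ n| * r ^ n := by
  obtain ⟨R, hrR, hR⟩ := exists_between hr
  have hR0 : 0 < R := hr0.trans_lt hrR
  obtain ⟨C, hC⟩ := exists_abs_a₅_mul_pow_le hR0 hR
  have h1 : ‖r / R‖ < 1 := by
    rw [Real.norm_of_nonneg (by positivity), div_lt_one hR0]; exact hrR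
  refine Summable.of_nonneg_of_le (fun n => by positivity) (fun n => ?_)
    ((summable_pow_mul_geometric_of_norm_lt_one (R := ℝ) k h1).mul_left C)
  calc (n : ℝ) ^ k * |a₅ n| * r ^ n = (|a₅ n| * R ^ n) * ((n : ℝ) ^ k * (r / R) ^ n) := by
        rw [div_pow]; field_simp
    _ ≤ C * ((n : ℝ) ^ k * (r / R) ^ n) := by gcongr; exact hC n

/-- The power series `∑ n ^ k * a₅ n * x ^ n`. -/
def eulerSeries (k : ℕ) (x : ℂ) : ℂ := ∑' n : ℕ, (n : ℂ) ^ k * (a₅ n : ℂ) * x ^ n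

lemma norm_eulerTerm (k n : ℕ) (x : ℂ) :
    ‖(n : ℂ) ^ k * (a₅ n : ℂ) * x ^ n‖ = (n : ℝ) ^ k * |a₅ n| * ‖x‖ ^ n := by
  simp

lemma hasSum_eulerSeries (k : ℕ) {x : ℂ} (hx : ‖x‖ < √5 / 25) :
    HasSum (fun n : ℕ => (n : ℂ) ^ k * (a₅ n : ℂ) * x ^ n) (eulerSeries k x) := by
  refine (Summable.of_norm ?_).hasSum
  simpa only [norm_eulerTerm] using summable_a₅ k (norm_nonneg x) hx

lemma hasDerivAt_eulerSeries (k : ℕ) {x : ℂ} (hx : ‖x‖ < √5 / 25) :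
    ∃ d, HasDerivAt (eulerSeries k) d x ∧ x * d = eulerSeries (k + 1) x := by
  obtain ⟨r, hxr, hr⟩ := exists_between hx
  have hr0 : 0 < r := (norm_nonneg x).trans_lt hxr
  have hu := (summable_a₅ (k + 1) hr0.le hr).mul_left r⁻¹
  have hxm : x ∈ Metric.ball (0 : ℂ) r := by rwa [mem_ball_zero_iff]
  have hd : ∀ (n : ℕ) (y : ℂ), y ∈ Metric.ball (0 : ℂ) r →
      HasDerivAt (fun y => (n : ℂ) ^ k * (a₅ n : ℂ) * y ^ n)
        ((n : ℂ) ^ k * (a₅ n : ℂ) * (n * y ^ (n - 1))) y := fun n y _ =>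
    (hasDerivAt_pow n y).const_mul _
  have hb : ∀ (n : ℕ) (y : ℂ), y ∈ Metric.ball (0 : ℂ) r →
      ‖(n : ℂ) ^ k * (a₅ n : ℂ) * (n * y ^ (n - 1))‖
        ≤ r⁻¹ * ((n : ℝ) ^ (k + 1) * |a₅ n| * r ^ n) := fun n y hy => by
    rw [mem_ball_zero_iff] at hy
    rcases n with _ | n
    · simp
    · rw [Nat.add_sub_cancel, norm_mul, norm_mul, norm_mul, norm_pow, norm_pow,
        Complex.norm_natCast, Complex.norm_real, Real.norm_eq_abs]
      calc ((n + 1 : ℕ) : ℝ) ^ k * |a₅ (n + 1)| * (((n + 1 : ℕ) : ℝ) * ‖y‖ ^ n)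
          ≤ ((n + 1 : ℕ) : ℝ) ^ k * |a₅ (n + 1)| * (((n + 1 : ℕ) : ℝ) * r ^ n) := by gcongr
        _ = _ := by field_simp; ring
  have hp : IsPreconnected (Metric.ball (0 : ℂ) r) := (convex_ball (0 : ℂ) r).isPreconnected
  refine ⟨_, hasDerivAt_tsum_of_isPreconnected hu Metric.isOpen_ball hp hd hb hxm
    (hasSum_eulerSeries k hx).summable hxm, ?_⟩
  rw [← tsum_mul_left, eulerSeries]
  refine tsum_congr fun n => ?_
  rcases n with _ | n
  · simp
  · rw [Nat.add_sub_cancel]; ring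

lemma continuousAt_eulerSeries (k : ℕ) {x : ℂ} (hx : ‖x‖ < √5 / 25) :
    ContinuousAt (eulerSeries k) x := by
  obtain ⟨d, h, -⟩ := hasDerivAt_eulerSeries k hx
  exact h.continuousAt

lemma eulerSeries_zero_zero : eulerSeries 0 0 = 1 := by
  rw [eulerSeries, tsum_eq_single 0 fun n hn => by simp [hn]]
  simp [a₅]

lemma eulerSeries_succ_zero (k : ℕ) : eulerSeries (k + 1) 0 = 0 := by
  rw [eulerSeries, tsum_eq_single 0 fun n hn => by simp [hn]]
  simp

/-- The differential equation of the generating function of `a₅`. -/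
lemma eulerSeries_ode {x : ℂ} (hx : ‖x‖ < √5 / 25) :
    eulerSeries 2 x
      + x * ((11 + 15 * (√5 : ℝ)) / 2 * (eulerSeries 2 x + eulerSeries 1 x)
        + 5 * (1 + (√5 : ℝ)) / 2 * eulerSeries 0 x)
      + 5 * (25 + 11 * (√5 : ℝ)) / 2 * x ^ 2
        * (eulerSeries 2 x + 2 * eulerSeries 1 x + eulerSeries 0 x) = 0 := by
  have h0 := hasSum_eulerSeries 0 hx
  have h1 := hasSum_eulerSeries 1 hx
  have h2 := hasSum_eulerSeries 2 hx
  have t1 := (hasSum_nat_add_iff' 1).mpr h2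
  have t2 := ((((h2.add h1).mul_left ((11 + 15 * (√5 : ℝ)) / 2 : ℂ)).add
    (h0.mul_left (5 * (1 + (√5 : ℝ)) / 2 : ℂ))).mul_left x)
  have t3 := ((h2.add (h1.mul_left 2)).add h0).mul_left
    (5 * (25 + 11 * (√5 : ℝ)) / 2 * x ^ 2 : ℂ)
  -- Reindexed by n + 1 so that all three series carry xⁿ⁺¹; the new term n = 0 vanishes because of
  -- the factor n².
  have t3' : HasSum (fun n : ℕ => 5 * (25 + 11 * (√5 : ℝ)) / 2 * (n : ℂ) ^ 2 * (a₅ (n - 1) : ℂ)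
      * x ^ (n + 1)) (5 * (25 + 11 * (√5 : ℝ)) / 2 * x ^ 2
        * (eulerSeries 2 x + 2 * eulerSeries 1 x + eulerSeries 0 x)) := by
    have := (hasSum_nat_add_iff (f := fun n : ℕ => 5 * (25 + 11 * (√5 : ℝ)) / 2 * (n : ℂ) ^ 2
      * (a₅ (n - 1) : ℂ) * x ^ (n + 1)) 1).mp (t3.congr_fun fun n => by
        rw [Nat.add_sub_cancel]; push_cast; ring)
    simpa using this
  have tot := ((t1.add t2).add t3').unique (hasSum_zero.congr_fun fun n => by
    have h : ((((n : ℝ) + 1) ^ 2 * a₅ (n + 1)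
      + ((11 + 15 * √5) / 2 * (n : ℝ) * ((n : ℝ) + 1) + 5 * (1 + √5) / 2) * a₅ n
      + 5 * (25 + 11 * √5) / 2 * (n : ℝ) ^ 2 * a₅ (n - 1) : ℝ) : ℂ) = 0 := by
      rw [a₅_recurrence]; simp
    push_cast at h ⊢
    linear_combination x ^ (n + 1) * h)
  simp only [Finset.range_one, Finset.sum_singleton] at tot
  linear_combination tot

/-! ### Limits at the cusp and the expansion of V. -/

lemma eventually_im_pos : ∀ᶠ τ : ℂ in comap Complex.im atTop, 0 < τ.im :=
  tendsto_comap.eventually_gt_atTop 0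

lemma tendsto_V : Tendsto V (comap Complex.im atTop) (𝓝 1) := by
  have h := (differentiableAt_nomeV (q := 0) (by simp)).continuousAt.tendsto.comp tendsto_nome
  rw [nomeV_at_zero] at h
  refine h.congr' ?_
  filter_upwards [eventually_im_pos] with τ hτ using (V_eq hτ).symm

lemma tendsto_W : Tendsto W (comap Complex.im atTop) (𝓝 1) := by
  have h := (differentiableAt_nomeW (q := 0) (by simp)).continuousAt.tendsto.comp tendsto_nome
  rw [nomeW_at_zero] at h
  refine h.congr' ?_
  filter_upwards [eventually_im_pos] with τ hτ using (W_eq hτ).symm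

lemma tendsto_L : Tendsto L (comap Complex.im atTop) (𝓝 0) := by
  obtain ⟨d, hd, -⟩ := mul_deriv_logV (q := 0) (by simp)
  have h := hd.continuousAt.tendsto.comp tendsto_nome
  rwa [logV_at_zero] at h

lemma tendsto_v : Tendsto v (comap Complex.im atTop) (𝓝 0) := by
  have h := ((tendsto_W.sub tendsto_V).div tendsto_V one_ne_zero).const_mul
    (1 / (5 * ((√5 : ℝ) : ℂ)))
  rw [sub_self, zero_div, mul_zero] at h
  exact h

lemma neBot_comap_im : (comap Complex.im atTop).NeBot :=
  comap_neBot fun t ht => by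
    obtain ⟨y, hy⟩ := nonempty_of_mem ht
    exact ⟨⟨0, y⟩, hy⟩

lemma isOpen_discPreimage : IsOpen discPreimage := by
  rw [isOpen_iff_mem_nhds]
  rintro τ ⟨h1, h2⟩
  have hc := (hasDerivAt_v h1).continuousAt.norm
  filter_upwards [upper_mem_nhds h1, hc.eventually_lt_const h2] with t ht1 ht2 using ⟨ht1, ht2⟩

/-- The factor `(1 + 5 √5 x) (1 + (11 + 5 √5) x / 2)` of `cubic`. -/
def quad (x : ℂ) : ℂ := (1 + 5 * (√5 : ℝ) * x) * (1 + (11 + 5 * (√5 : ℝ)) / 2 * x)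

lemma hasDerivAt_quad (x : ℂ) : HasDerivAt quad ((11 + 15 * (√5 : ℝ)) / 2
    + 5 * (25 + 11 * (√5 : ℝ)) * x) x := by
  have h := (((hasDerivAt_id' x).const_mul (5 * (√5 : ℝ) : ℂ)).const_add 1).fun_mul
    (((hasDerivAt_id' x).const_mul ((11 + 5 * (√5 : ℝ)) / 2 : ℂ)).const_add 1)
  refine h.congr_deriv ?_
  linear_combination 25 * x * sqrt_five_sq

lemma quad_zero : quad 0 = 1 := by simp [quad]

/-- The composition of `eulerSeries k` with `v`. -/
def eulerV (k : ℕ) (τ : ℂ) : ℂ := eulerSeries k (v τ)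

lemma hasDerivAt_eulerV (k : ℕ) {τ : ℂ} (hτ : τ ∈ discPreimage) :
    HasDerivAt (eulerV k) (twoPiI * (V τ ^ 2 * quad (v τ) * eulerV (k + 1) τ)) τ := by
  obtain ⟨d, h, e⟩ := hasDerivAt_eulerSeries k hτ.2
  refine (h.comp τ (hasDerivAt_v hτ.1)).congr_deriv ?_
  rw [eulerV, ← e, cubic, quad]
  ring

/-- The Wronskian of `V` and the generating function of `a₅` composed with `v`. -/
def wronskian (τ : ℂ) : ℂ := V τ * quad (v τ) * eulerV 1 τ - eulerV 0 τ * L τ / V τ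

/-- With f the generating function, this is c(v)(V f' - f dV/dv), constant because V and f(v) solve
the same self-adjoint equation. Working in τ avoids choosing a branch of the inverse of v. -/
lemma hasDerivAt_wronskian {τ : ℂ} (hτ : τ ∈ discPreimage) : HasDerivAt wronskian 0 τ := by
  have hV := V_ne_zero hτ.1
  have dq : HasDerivAt (fun τ => quad (v τ)) _ τ :=
    (hasDerivAt_quad (v τ)).comp τ (hasDerivAt_v hτ.1)
  have h := (((hasDerivAt_V hτ.1).fun_mul dq).fun_mul (hasDerivAt_eulerV 1 hτ)).fun_sub
    (((hasDerivAt_eulerV 0 hτ).fun_mul (hasDerivAt_L' hτ.1)).fun_div (hasDerivAt_V hτ.1) hV)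
  refine h.congr_deriv ?_
  have ode := eulerSeries_ode hτ.2
  have hc : cubic (v τ) = v τ * quad (v τ) := by rw [cubic, quad]; ring
  have hq : quad (v τ) = 1 + (11 + 15 * (√5 : ℝ)) / 2 * v τ
      + 5 * (25 + 11 * (√5 : ℝ)) / 2 * v τ ^ 2 := by
    rw [quad]; linear_combination 25 / 2 * v τ ^ 2 * sqrt_five_sq
  rw [hc]
  simp only [eulerV, zero_add, Nat.reduceAdd]
  have key : quad (v τ) * eulerSeries 2 (v τ)
      + ((11 + 15 * (√5 : ℝ)) / 2 + 5 * (25 + 11 * (√5 : ℝ)) * v τ) * v τ * eulerSeries 1 (v τ)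
      + (5 * (25 + 11 * (√5 : ℝ)) / 2 * v τ + 5 * (1 + (√5 : ℝ)) / 2) * v τ * eulerSeries 0 (v τ)
      = 0 := by
    rw [hq]; linear_combination ode
  generalize 5 * (25 + 11 * ((√5 : ℝ) : ℂ)) / 2 * v τ + 5 * (1 + ((√5 : ℝ) : ℂ)) / 2 = l at *
  generalize (11 + 15 * ((√5 : ℝ) : ℂ)) / 2 + 5 * (25 + 11 * ((√5 : ℝ) : ℂ)) * v τ = m at *
  clear h dq ode hq hc
  generalize quad (v τ) = p at *
  generalize V τ = y at *
  field_simp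
  linear_combination twoPiI * y ^ 4 * p * key

/-- The expansion of `V` in powers of `v` on connected sets that reach the cusp. -/
lemma hasSum_V {K : Set ℂ} (hK : IsOpen K) (hK' : IsPreconnected K) (hsub : K ⊆ discPreimage)
    (hcusp : ∀ᶠ τ in comap Complex.im atTop, τ ∈ K) {τ : ℂ} (hτ : τ ∈ K) :
    HasSum (fun n : ℕ => (a₅ n : ℂ) * v τ ^ n) (V τ) := by
  have := neBot_comap_im
  have h5 : (0 : ℝ) < √5 / 25 := by positivity
  have lim : ∀ k, Tendsto (eulerV k) (comap Complex.im atTop) (𝓝 (eulerSeries k 0)) := fun k =>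
    (continuousAt_eulerSeries k (by simp)).tendsto.comp tendsto_v
  have const : ∀ {f : ℂ → ℂ} {c : ℂ}, (∀ t ∈ K, HasDerivAt f 0 t) →
      Tendsto f (comap Complex.im atTop) (𝓝 c) → ∀ t ∈ K, f t = c := by
    intro f c hf hl t ht
    refine tendsto_nhds_unique (tendsto_const_nhds.congr' ?_) hl
    filter_upwards [hcusp] with s hs
    exact hK.is_const_of_deriv_eq_zero hK'
      (fun u hu => (hf u hu).differentiableAt.differentiableWithinAt)
      (fun u hu => (hf u hu).deriv) ht hs
  have lim0 := lim 0
  have lim1 := lim 1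
  rw [eulerSeries_zero_zero] at lim0
  rw [eulerSeries_succ_zero] at lim1
  have limq : Tendsto (fun τ => quad (v τ)) (comap Complex.im atTop) (𝓝 1) := by
    have := (hasDerivAt_quad 0).continuousAt.tendsto.comp tendsto_v
    rwa [quad_zero] at this
  -- Both terms tend to 0 at the cusp: `eulerSeries 1` vanishes at 0, and L tends to 0.
  have hw := const (f := wronskian) (c := 0) (fun t ht => hasDerivAt_wronskian (hsub ht)) (by
    have := ((tendsto_V.mul limq).mul lim1).sub ((lim0.mul tendsto_L).div tendsto_V one_ne_zero)
    simpa using! this)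
  have hratio := const (f := fun t => eulerV 0 t / V t) (c := 1) (fun t ht => by
    have hV := V_ne_zero (hsub ht).1
    refine ((hasDerivAt_eulerV 0 (hsub ht)).fun_div (hasDerivAt_V (hsub ht).1) hV).congr_deriv ?_
    have := hw t ht
    rw [wronskian] at this
    rw [div_eq_zero_iff]
    left
    field_simp at this
    rw [zero_add]
    linear_combination twoPiI * V t * this) (by
    have := lim0.div tendsto_V one_ne_zero
    simpa using! this)
  have e : eulerSeries 0 (v τ) = V τ := by
    have := hratio τ hτ
    rwa [div_eq_one_iff_eq (V_ne_zero (hsub hτ).1)] at this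
  have := hasSum_eulerSeries 0 (hsub hτ).2
  rw [e] at this
  simpa using this

lemma exists_height : ∃ Y : ℝ, 0 < Y ∧ {τ : ℂ | Y < τ.im} ⊆ discPreimage := by
  have h5 : (0 : ℝ) < √5 / 25 := by positivity
  have h := tendsto_v.norm.eventually_lt_const (by rwa [norm_zero])
  obtain ⟨t, ht, hs⟩ := mem_comap.mp h
  obtain ⟨y, hy⟩ := mem_atTop_sets.mp ht
  refine ⟨max y 1, by positivity, fun τ hτ => ⟨?_, hs (hy _ ?_)⟩⟩
  · exact lt_trans (by positivity) hτ
  · exact (le_max_left y 1).trans (le_of_lt hτ)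

end LevelFive

end

theorem mainTheorem2 :
    -- the sequence: initial value and recurrence (at `n = 0` the last term has the factor `0`)
    LevelFive.a₅ 0 = 1 ∧
    (∀ n : ℕ,
      ((n : ℝ) + 1) ^ 2 * LevelFive.a₅ (n + 1)
        + ((11 + 15 * √5) / 2 * (n : ℝ) * ((n : ℝ) + 1) + 5 * (1 + √5) / 2) * LevelFive.a₅ n
        + 5 * (25 + 11 * √5) / 2 * (n : ℝ) ^ 2 * LevelFive.a₅ (n - 1) = 0) ∧
    -- `V` has no zeros, so that `v` is defined on the whole upper half plane
    (∀ τ : ℂ, 0 < τ.im → LevelFive.V τ ≠ 0) ∧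
    -- the expansion on the connected component, containing a half plane `Im τ > Y`,
    -- of the set where `|v| < √5 / 25`
    (∃ Y : ℝ, 0 < Y ∧
      {τ : ℂ | Y < τ.im} ⊆ LevelFive.discPreimage ∧
      ∀ τ₀ : ℂ, Y < τ₀.im → ∀ τ ∈ connectedComponentIn LevelFive.discPreimage τ₀,
        HasSum (fun n : ℕ => (LevelFive.a₅ n : ℂ) * LevelFive.v τ ^ n) (LevelFive.V τ)) ∧
    -- the inverse function `τ = τ(v)` exists locally, near every point
    (∀ τ₀ : ℂ, 0 < τ₀.im → ∃ (Ω : Set ℂ) (σ : ℂ → ℂ),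
      LevelFive.IsInverseBranch Ω σ ∧ LevelFive.v τ₀ ∈ Ω ∧ σ (LevelFive.v τ₀) = τ₀) ∧
    -- Heun's equation for `V` as a function of `v`, along every branch of the inverse function
    (∀ (Ω : Set ℂ) (σ : ℂ → ℂ), LevelFive.IsInverseBranch Ω σ →
      DifferentiableOn ℂ (fun x => LevelFive.V (σ x)) Ω ∧
      ∀ x ∈ Ω, x ≠ 0 ∧ x + (√5 : ℝ) / 25 ≠ 0 ∧ x - (11 - 5 * (√5 : ℝ)) / 2 ≠ 0 ∧
        LevelFive.HeunAt (fun x => LevelFive.V (σ x)) x) := by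
  refine ⟨rfl, LevelFive.a₅_recurrence, fun τ hτ => LevelFive.V_ne_zero hτ, ?_,
    fun τ₀ h₀ => LevelFive.exists_inverseBranch h₀, fun Ω σ h => ⟨fun x hx =>
      (LevelFive.hasDerivAt_V_branch h hx).differentiableAt.differentiableWithinAt, fun x hx => ?_⟩⟩
  · obtain ⟨Y, hY, hsub⟩ := LevelFive.exists_height
    refine ⟨Y, hY, hsub, fun τ₀ h₀ τ hτ => ?_⟩
    refine LevelFive.hasSum_V LevelFive.isOpen_discPreimage.connectedComponentIn
      isPreconnected_connectedComponentIn (connectedComponentIn_subset _ _) ?_ hτ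
    -- The half plane is convex, so it lies in the component of each of its points, and that
    -- component reaches the cusp.
    have hhalf : {τ : ℂ | Y < τ.im} ⊆ connectedComponentIn LevelFive.discPreimage τ₀ :=
      (convex_halfSpace_im_gt Y).isPreconnected.subset_connectedComponentIn h₀ hsub
    filter_upwards [Filter.tendsto_comap.eventually_gt_atTop Y] with t ht using hhalf ht
  · obtain ⟨h1, h2, h3⟩ := LevelFive.branch_point_ne h hx
    exact ⟨h1, h2, h3, LevelFive.heunAt_branch h hx⟩
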